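/- **Problem.** Let $f:\mathbb R^n\to\mathbb R$, let $\mathcal G_1,\dots,\mathcal G_m$ be a partition of $\{1,\dots,n\}$ into nonempty groups, let $\lambda_1,\dots,\lambda_m>0$, and put $r(x)=\sum_{i=1}^m\lambda_i\|[x]_{\mathcal G_i}\|_2$, $F=f+r$. Here $[x]_I$ is the subvector of $x$ indexed by $I$, $P_I(x)$ agrees with $x$ on $I$ and is $0$ off $I$, $\nabla_I$ and $\nabla^2_{II}$ denote the gradient and Hessian with respect to the variables in $I$, and $\|[\cdot]_\emptyset\|_2=0$. **Algorithm.** Constants: $\varphi,\xi,\eta,\zeta\in(0,1)$, $\kappa_1,\kappa_2,p\in(0,\infty)$, $\theta\in(0,\pi/2)$, $q\in[1,2]$. Start with $x_0\in\mathbb R^n$, $\alpha_0\in(0,1]$. For $k=0,1,2,\dots$ let $$s_k=\operatorname*{argmin}_{y}\Big\{\tfrac1{2\alpha_k}\|y-(x_k-\alpha_k\nabla f(x_k))\|_2^2+r(y)\Big\}-x_k ,$$ let $\bar{\mathcal I}_k$ be the union of the groups $\mathcal G_i$ with $[x_k]_{\mathcal G_i}\ne0$, $[x_k+s_k]_{\mathcal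 G_i}\neq0$ and $\|[x_k]_{\mathcal G_i}\|_2\ge\kappa_1\|\nabla_{\mathcal G_i}F(x_k)\|_2$; obtain $\mathcal I^{cg}_k$ from $\bar{\mathcal I}_k$ by removing the groups $\mathcal G_i\subseteq\bar{\mathcal I}_k$ with $\|[x_k]_{\mathcal G_i}\|_2<\kappa_2\|\nabla_{\bar{\mathcal I}_k}F(x_k)\|_2^p$; let $\mathcal I^{pg}_k=\{1,\dots,n\}\setminus\mathcal I^{cg}_k$, $\chi^{cg}_k=\|[s_k]_{\mathcal I^{cg}_k}\|_2$ and $\chi^{pg}_k=\|[s_k]_{\mathcal I^{pg}_k}\|_2$. Let $\mathcal K^{cg}=\{k:\chi^{pg}_k\le\chi^{cg}_k\}$. *If $k\in\mathcal K^{cg}$:* choose a union of groups $\mathcal I_k\subseteq\mathcal I^{cg}_k$ with $\|[s_k]_{\mathcal I_k}\|_2\ge\varphi\chi^{cg}_k$; put $g_k=\nabla_{\mathcal I_k}F(x_k)$; choose a symmetric positive definite $H_k\in\mathbb R^{|\mathcal I_k|\times|\mathcal I_k|}$, a number $\mu_k\in(0,1]$, and $\bar d_k\in\mathbb R^{|\mathcal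 I_k|}$ with $$g_k^T\bar d_k\le g_k^Td^R_k,\qquad g_k^T\bar d_k+\tfrac12\bar d_k^TH_k\bar d_k\le0,\qquad \|H_k\bar d_k+g_k\|_2\le\mu_k\|g_k\|_2^q,$$ where $d_k^R=-\frac{\|g_k\|_2^2}{g_k^TH_kg_k}g_k$. Let $[d_k]_{\mathcal I_k}=\bar d_k$, and $d_k=0$ off $\mathcal I_k$. For $\mathcal G_i\subseteq\mathcal I_k$ let $\rho_{k,i}=\max\{\kappa_1\|\nabla_{\mathcal G_i}F(x_k)\|_2,\kappa_2\|\nabla_{\mathcal I^{cg}_k}F(x_k)\|_2^p\}$ and $\bar\rho_{k,i}=\min\{\rho_{k,i},\sin(\theta)\|[x_k]_{\mathcal G_i}\|_2\}$; let $\tau_{k,i}=\infty$ if $\|[x_k+\tau d_k]_{\mathcal G_i}\|_2>\bar\rho_{k,i}$ for all $\tau\ge0$, and otherwise let $\tau_{k,i}$ be the smallest positive root $\tau$ of $\|[x_k+\tau d_k]_{\mathcal G_i}\|_2=\bar\rho_{k,i}$; let $\tau_k=\min_i\tau_{k,i}$. For $j=0,1,2,\dots$: if $\xi^j\ge\tau_k$,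 let $y_j$ be obtained from $x_k+\xi^jd_k$ by setting the groups $\mathcal G_i\subseteq\mathcal I_k$ with $\xi^j\ge\tau_{k,i}$ to $0$, and accept $y_j$ if $F(y_j)\le F(x_k)$; if $\xi^j<\tau_k$, let $y_j=x_k+\xi^jd_k$, and accept $y_j$ if $F(y_j)\le F(x_k)+\eta\xi^jg_k^T\bar d_k$. Let $x_{k+1}$ be the first accepted $y_j$ and $\alpha_{k+1}=\alpha_k$. *If $k\notin\mathcal K^{cg}$:* choose a union of groups $\mathcal I_k\subseteq\mathcal I^{pg}_k$ with $\|[s_k]_{\mathcal I_k}\|_2\ge\varphi\chi^{pg}_k$; let $j\ge0$ be the smallest integer with $F(x_k+\xi^jP_{\mathcal I_k}(s_k))\le F(x_k)-\eta\xi^j\frac1{\alpha_k}\|P_{\mathcal I_k}(s_k)\|_2^2$; set $x_{k+1}=x_k+\xi^jP_{\mathcal I_k}(s_k)$, and $\alpha_{k+1}=\alpha_k$ if $j=0$, $\alpha_{k+1}=\zeta\alpha_k$ if $j>0$. **Theorem.** Suppose that $f$ is twice continuously differentiable and strongly convex, and let $x_*$ be the minimizer of $F$. Suppose that $\nabla^2f$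 is Lipschitz continuous in a neighborhood of $x_*$ and that $\|[\nabla f(x_*)]_{\mathcal G_i}\|_2<\lambda_i$ whenever $[x_*]_{\mathcal G_i}=0$. Let $\{x_k\}$ be an infinite sequence generated by the algorithm such that - $\max\{\chi^{cg}_k,\chi^{pg}_k\}>0$ for all $k$; - there are $0<\mu_{\min}\le\mu_{\max}<\infty$ with $\mu_{\min}\|v\|_2^2\le v^TH_kv\le\mu_{\max}\|v\|_2^2$ for all $k\in\mathcal K^{cg}$ and all $v$; - $\eta<1/2$; - for all sufficiently large $k$, $\mathcal I_k=\mathcal I^{cg}_k$ if $k\in\mathcal K^{cg}$, and $\mathcal I_k=\mathcal I^{pg}_k$ if $k\notin\mathcal K^{cg}$; - for all sufficiently large $k\in\mathcal K^{cg}$, $H_k=\nabla^2_{\mathcal I_k\mathcal I_k}F(x_k)$. If either $q\in(1,2]$, or $q=1$ and $\mu_k\to0$ (along $k\in\mathcal K^{cg}$), then $x_k\to x_*$ superlinearly, i.e. $x_k\to x_*$ and $\|x_{k+1}-x_*\|_2=o(\|x_k-x_*\|_2)$. If $q=2$, then the convergence is quadratic, i.e. in addition $\|x_{k+1}-x_*\|_2=O(\|x_k-x_*\|_2^2)$.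 -/

import Mathlib

open Filter Topology Asymptotics

noncomputable section

namespace FaRSA

/-- `ℝⁿ` with the Euclidean norm. -/
abbrev E (n : ℕ) := EuclideanSpace ℝ (Fin n)

/-- The subvector `[x]_I ∈ ℝ^{|I|}`; its norm is the Euclidean norm. -/
def sub {n : ℕ} (I : Finset (Fin n)) (x : E n) : EuclideanSpace ℝ I :=
  WithLp.toLp 2 (fun j : I => x j)

/-- The vector `d ∈ ℝⁿ` with `[d]_I = v` and `[d]_{Iᶜ} = 0`. -/
def pad {n : ℕ} (I : Finset (Fin n)) (v : EuclideanSpace ℝ I) : E n :=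
  WithLp.toLp 2 (fun j => if h : j ∈ I then v ⟨j, h⟩ else 0)

/-- The projection `P_I(x)` onto the coordinate subspace indexed by `I`. -/
def proj {n : ℕ} (I : Finset (Fin n)) (x : E n) : E n :=
  WithLp.toLp 2 (fun j => if j ∈ I then x j else 0)

/-- The partial derivative of `h` with respect to the `j`-th coordinate at `x`. -/
def partialD {n : ℕ} (h : E n → ℝ) (j : Fin n) (x : E n) : ℝ :=
  lineDeriv ℝ h x (EuclideanSpace.single j 1)

/-- The reduced gradient `∇_I h(x) ∈ ℝ^{|I|}`. -/
def gradSub {n : ℕ} (I : Finset (Fin n)) (h : E n → ℝ) (x : E n) : EuclideanSpace ℝ I :=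
  WithLp.toLp 2 (fun j : I => partialD h j x)

/-- The reduced Hessian `∇²_{II} h(x) ∈ ℝ^{|I| × |I|}`. -/
def hessSub {n : ℕ} (I : Finset (Fin n)) (h : E n → ℝ) (x : E n) : Matrix I I ℝ :=
  Matrix.of fun a b => partialD (partialD h b) a x

/-- Product of a matrix and a Euclidean vector. -/
def mulV {ι : Type} [Fintype ι] (H : Matrix ι ι ℝ) (v : EuclideanSpace ℝ ι) :
    EuclideanSpace ℝ ι :=
  WithLp.toLp 2 (H.mulVec v.ofLp)

/-- The data of `min f(x) + ∑ᵢ λᵢ ‖[x]_{Gᵢ}‖₂`, where the (nonempty) groups `Gᵢ` form a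
partition of the coordinates and the weights `λᵢ` are positive. -/
structure Problem (n m : ℕ) where
  f : E n → ℝ
  G : Fin m → Finset (Fin n)
  weight : Fin m → ℝ
  group_nonempty : ∀ i, (G i).Nonempty
  group_disjoint : ∀ i i', i ≠ i' → Disjoint (G i) (G i')
  group_cover : ∀ j, ∃ i, j ∈ G i
  weight_pos : ∀ i, 0 < weight i

/-- The constants of the algorithm. -/
structure Constants where
  (φ ξ η ζ κ₁ κ₂ p θ q : ℝ)
  φ_mem : φ ∈ Set.Ioo 0 1
  ξ_mem : ξ ∈ Set.Ioo 0 1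
  η_mem : η ∈ Set.Ioo 0 1
  ζ_mem : ζ ∈ Set.Ioo 0 1
  κ₁_pos : 0 < κ₁
  κ₂_pos : 0 < κ₂
  p_pos : 0 < p
  θ_mem : θ ∈ Set.Ioo 0 (Real.pi / 2)
  q_mem : q ∈ Set.Icc 1 2

variable {n m : ℕ}

namespace Problem

/-- The regularizer `r(x) = ∑ᵢ λᵢ ‖[x]_{Gᵢ}‖₂`. -/
def r (P : Problem n m) (x : E n) : ℝ := ∑ i, P.weight i * ‖sub (P.G i) x‖

/-- The objective function `f + r`. -/
def F (P : Problem n m) (x : E n) : ℝ := P.f x + P.r x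

/-- `s` is the proximal gradient step `s(x, α) = T(x, α) - x`, i.e. `x + s` is the minimizer
`T(x, α)` of `y ↦ (1/(2α)) ‖y - (x - α ∇f(x))‖² + r(y)`. -/
def IsPGStep (P : Problem n m) (x : E n) (α : ℝ) (s : E n) : Prop :=
  IsMinOn (fun y => 1 / (2 * α) * ‖y - (x - α • gradient P.f x)‖ ^ 2 + P.r y) Set.univ (x + s)

/-- `I` is the union of some of the groups. -/
def IsGroupUnion (P : Problem n m) (I : Finset (Fin n)) : Prop :=
  ∃ A : Finset (Fin m), I = A.biUnion P.G

open Classical in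
/-- The set of candidate variables `Ī^cg` (at the point `x` with PG step `s`). -/
def IcgBar (P : Problem n m) (c : Constants) (x s : E n) : Finset (Fin n) :=
  Finset.univ.filter fun j => ∃ i, j ∈ P.G i ∧ sub (P.G i) x ≠ 0 ∧ sub (P.G i) (x + s) ≠ 0 ∧
    c.κ₁ * ‖gradSub (P.G i) P.F x‖ ≤ ‖sub (P.G i) x‖

open Classical in
/-- The set `I^small`. -/
def Ismall (P : Problem n m) (c : Constants) (x s : E n) : Finset (Fin n) :=
  Finset.univ.filter fun j => ∃ i, j ∈ P.G i ∧ P.G i ⊆ P.IcgBar c x s ∧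
    ‖sub (P.G i) x‖ < c.κ₂ * ‖gradSub (P.IcgBar c x s) P.F x‖ ^ c.p

/-- The set `I^cg = Ī^cg \ I^small`. -/
def Icg (P : Problem n m) (c : Constants) (x s : E n) : Finset (Fin n) :=
  P.IcgBar c x s \ P.Ismall c x s

/-- The set `I^pg = {1, …, n} \ I^cg`. -/
def Ipg (P : Problem n m) (c : Constants) (x s : E n) : Finset (Fin n) :=
  Finset.univ \ P.Icg c x s

/-- The optimality measure `χ^cg`. -/
def χcg (P : Problem n m) (c : Constants) (x s : E n) : ℝ := ‖sub (P.Icg c x s) s‖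

/-- The optimality measure `χ^pg`. -/
def χpg (P : Problem n m) (c : Constants) (x s : E n) : ℝ := ‖sub (P.Ipg c x s) s‖

/-- The radius `ρ_{k,i}`. -/
def ρ (P : Problem n m) (c : Constants) (x s : E n) (i : Fin m) : ℝ :=
  max (c.κ₁ * ‖gradSub (P.G i) P.F x‖) (c.κ₂ * ‖gradSub (P.Icg c x s) P.F x‖ ^ c.p)

/-- The radius `ρ̄_{k,i}`. -/
def ρbar (P : Problem n m) (c : Constants) (x s : E n) (i : Fin m) : ℝ :=
  min (P.ρ c x s i) (Real.sin c.θ * ‖sub (P.G i) x‖)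

open Classical in
/-- The step size `τ_{k,i}`: it is `∞` if the ray `{[x + t d]_{Gᵢ} : t ≥ 0}` misses the closed
ball of radius `ρ̄_{k,i}` about zero, and the smallest positive root `t` of
`‖[x + t d]_{Gᵢ}‖ = ρ̄_{k,i}` otherwise. -/
def τgroup (P : Problem n m) (c : Constants) (x s d : E n) (i : Fin m) : EReal :=
  if ∀ t : ℝ, 0 ≤ t → P.ρbar c x s i < ‖sub (P.G i) (x + t • d)‖ then ⊤
  else ((sInf {t : ℝ | 0 < t ∧ ‖sub (P.G i) (x + t • d)‖ = P.ρbar c x s i} : ℝ) : EReal)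

open Classical in
/-- The step size `τ_k`, the minimum of the `τ_{k,i}` with `Gᵢ ⊆ I`. -/
def τmin (P : Problem n m) (c : Constants) (x s d : E n) (I : Finset (Fin n)) : EReal :=
  (Finset.univ.filter fun i => P.G i ⊆ I).inf (P.τgroup c x s d)

open Classical in
/-- The `j`-th trial point of the search along `d`: while `ξ^j ≥ τ_k`, the groups `Gᵢ ⊆ I` with
`ξ^j ≥ τ_{k,i}` are set to zero, those with `ξ^j < τ_{k,i}` are moved along `d`, and the
coordinates outside `I` are kept; after that the trial point is `x + ξ^j d`. -/
def cgTrial (P : Problem n m) (c : Constants) (x s d : E n) (I : Finset (Fin n)) (j : ℕ) : E n :=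
  if P.τmin c x s d I ≤ ((c.ξ ^ j : ℝ) : EReal) then
    WithLp.toLp 2 fun a =>
      if a ∈ I then
        if ∃ i, a ∈ P.G i ∧ P.τgroup c x s d i ≤ ((c.ξ ^ j : ℝ) : EReal) then 0
        else x a + c.ξ ^ j * d a
      else x a
  else x + c.ξ ^ j • d

open Classical in
/-- The test that ends the search along `d` at the `j`-th trial point: simple decrease in the
projected phase `ξ^j ≥ τ_k`, the Armijo condition afterwards. -/
def cgAccept (P : Problem n m) (c : Constants) (x s d : E n) (I : Finset (Fin n)) (j : ℕ) : Prop :=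
  if P.τmin c x s d I ≤ ((c.ξ ^ j : ℝ) : EReal) then
    P.F (P.cgTrial c x s d I j) ≤ P.F x
  else
    P.F (P.cgTrial c x s d I j) ≤
      P.F x + c.η * c.ξ ^ j * inner ℝ (gradSub I P.F x) (sub I d)

/-- The Armijo test of the search along the PG step. -/
def pgAccept (P : Problem n m) (c : Constants) (x s : E n) (α : ℝ) (I : Finset (Fin n))
    (j : ℕ) : Prop :=
  P.F (x + c.ξ ^ j • proj I s) ≤ P.F x - c.η * c.ξ ^ j * (1 / α) * ‖proj I s‖ ^ 2

end Problem

/-- The quadratic model `m(d) = gᵀd + ½ dᵀHd`. -/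
def model {ι : Type} [Fintype ι] (g : EuclideanSpace ℝ ι) (H : Matrix ι ι ℝ)
    (d : EuclideanSpace ℝ ι) : ℝ :=
  inner ℝ g d + 1 / 2 * inner ℝ d (mulV H d)

/-- The reference direction `d^R = -β g` with `β = ‖g‖² / (gᵀHg)`. -/
def refDir {ι : Type} [Fintype ι] (g : EuclideanSpace ℝ ι) (H : Matrix ι ι ℝ) :
    EuclideanSpace ℝ ι :=
  -((‖g‖ ^ 2 / inner ℝ g (mulV H g)) • g)

/-- `d` is an admissible output of the subroutine `cg_direction(g, H)` with tolerance `μ` and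
exponent `q`. -/
def IsCGDirection {ι : Type} [Fintype ι] (g : EuclideanSpace ℝ ι) (H : Matrix ι ι ℝ) (μ q : ℝ)
    (d : EuclideanSpace ℝ ι) : Prop :=
  inner ℝ g d ≤ (inner ℝ g (refDir g H) : ℝ) ∧ model g H d ≤ model g H 0 ∧
    ‖mulV H d + g‖ ≤ μ * ‖g‖ ^ q

/-- The sequences produced in an infinite run of the algorithm: iterates `x k`, PG parameters
`α k`, PG steps `s k` and working sets `I k`, and, in the iterations with `χ^pg ≤ χ^cg` (only there
are they constrained), matrices `H k`, tolerances `μ k` and reduced directions `dbar k`. -/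
structure Trace (n : ℕ) where
  x : ℕ → E n
  α : ℕ → ℝ
  s : ℕ → E n
  I : ℕ → Finset (Fin n)
  H : ∀ k, Matrix (I k) (I k) ℝ
  μ : ℕ → ℝ
  dbar : ∀ k, EuclideanSpace ℝ (I k)

namespace Trace

/-- The set `K^cg` of iterations in which `χ^pg_k ≤ χ^cg_k`. -/
def Kcg (t : Trace n) (P : Problem n m) (c : Constants) : Set ℕ :=
  {k | P.χpg c (t.x k) (t.s k) ≤ P.χcg c (t.x k) (t.s k)}

/-- One iteration with `χ^pg ≤ χ^cg`. -/
structure CGStep (t : Trace n) (P : Problem n m) (c : Constants) (k : ℕ) : Prop where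
  subset : t.I k ⊆ P.Icg c (t.x k) (t.s k)
  union : P.IsGroupUnion (t.I k)
  large : c.φ * P.χcg c (t.x k) (t.s k) ≤ ‖sub (t.I k) (t.s k)‖
  posDef : (t.H k).PosDef
  μ_mem : t.μ k ∈ Set.Ioc 0 1
  direction : IsCGDirection (gradSub (t.I k) P.F (t.x k)) (t.H k) (t.μ k) c.q (t.dbar k)
  x_next : ∃ j : ℕ,
    IsLeast {j | P.cgAccept c (t.x k) (t.s k) (pad (t.I k) (t.dbar k)) (t.I k) j} j ∧
      t.x (k + 1) = P.cgTrial c (t.x k) (t.s k) (pad (t.I k) (t.dbar k)) (t.I k) j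
  α_next : t.α (k + 1) = t.α k

/-- One iteration with `χ^pg > χ^cg`; the PG parameter is reduced exactly if the search needed
`j > 0`. -/
structure PGStep (t : Trace n) (P : Problem n m) (c : Constants) (k : ℕ) : Prop where
  subset : t.I k ⊆ P.Ipg c (t.x k) (t.s k)
  union : P.IsGroupUnion (t.I k)
  large : c.φ * P.χpg c (t.x k) (t.s k) ≤ ‖sub (t.I k) (t.s k)‖
  next : ∃ j : ℕ,
    IsLeast {j | P.pgAccept c (t.x k) (t.s k) (t.α k) (t.I k) j} j ∧
      t.x (k + 1) = t.x k + c.ξ ^ j • proj (t.I k) (t.s k) ∧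
      t.α (k + 1) = if j = 0 then t.α k else c.ζ * t.α k

/-- `t` is an infinite run of the algorithm on the problem `P` with constants `c`. -/
structure IsRun (t : Trace n) (P : Problem n m) (c : Constants) : Prop where
  α_zero : t.α 0 ∈ Set.Ioc 0 1
  pgStep : ∀ k, P.IsPGStep (t.x k) (t.α k) (t.s k)
  cg : ∀ k, k ∈ t.Kcg P c → t.CGStep P c k
  pg : ∀ k, k ∉ t.Kcg P c → t.PGStep P c k

end Trace

/-- (Q-)superlinear convergence. -/
def ConvergesSuperlinearly (x : ℕ → E n) (a : E n) : Prop :=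
  Tendsto x atTop (𝓝 a) ∧
    (fun k => ‖x (k + 1) - a‖) =o[atTop] (fun k => ‖x k - a‖)

/-- (Q-)quadratic convergence. -/
def ConvergesQuadratically (x : ℕ → E n) (a : E n) : Prop :=
  Tendsto x atTop (𝓝 a) ∧
    (fun k => ‖x (k + 1) - a‖) =O[atTop] (fun k => ‖x k - a‖ ^ 2)

end FaRSA

end

/-! Global convergence. Strong convexity makes `F` grow quadratically around the minimizer
(`growth`). A proximal step `s` yields a subgradient of `F` at `x + s`, so `‖x k - xstar‖ ≤ C ‖s k‖`
once the parameters `α k` are bounded below (`exists_α_ge`). Since `F (x k)` decreases, it is enough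
that some `s k` is arbitrarily small (`tendsto_of_exists_norm_s_lt`). Infinitely many proximal
iterations force this by sufficient decrease. Otherwise only subspace iterations remain. In these a
zero group stays zero, so only finitely many of them project a group to zero; the others are Armijo
steps. An Armijo step lowers `F` by a fixed amount as long as the reduced gradient is bounded away
from zero (`exists_le_F_sub_of_armijo`): removing the small groups keeps `[x]_{Gᵢ}` away from the
origin, which bounds the curvature of `r`.

Identification. Nondegeneracy makes the proximal step annihilate every group that vanishes at
`xstar`, and the remaining groups pass all thresholds because the reduced gradient tends to zero
there. Hence `Icg` finally equals the support of `xstar`; the iterates vanish off it, the proximal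
measure is zero, and every iteration is a subspace iteration (`eventually_mem_Kcg`).

Rate. On the coordinate subspace of the support, `F` is C² near `xstar` with Lipschitz Hessian, and
the method is an inexact Newton method with residual at most `ν k ‖g‖`, where `ν k = μ k ‖g‖ ^ (q -
1)` tends to zero. Its steps tend to zero, so no group is projected, and `η < 1/2` makes the unit
step acceptable. This leaves `a e(k+1) ≤ K e(k)² + ν k M e(k)` for the errors `e(k) = ‖x k -
xstar‖`, with `ν k ≤ M e(k)` if `q = 2`. -/

namespace FaRSA

variable {n m : ℕ}

/-! ### Subvectors, padding and coordinate projections -/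

@[simp] lemma sub_apply (I : Finset (Fin n)) (x : E n) (j : I) : sub I x j = x j := rfl

@[simp] lemma proj_apply (I : Finset (Fin n)) (x : E n) (j : Fin n) :
    proj I x j = if j ∈ I then x j else 0 := rfl

lemma pad_apply (I : Finset (Fin n)) (v : EuclideanSpace ℝ I) (j : Fin n) :
    pad I v j = if h : j ∈ I then v ⟨j, h⟩ else 0 := rfl

lemma sub_add (I : Finset (Fin n)) (x y : E n) : sub I (x + y) = sub I x + sub I y := rfl

lemma sub_sub (I : Finset (Fin n)) (x y : E n) : sub I (x - y) = sub I x - sub I y := rfl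

lemma sub_smul (I : Finset (Fin n)) (a : ℝ) (x : E n) : sub I (a • x) = a • sub I x := rfl

lemma sub_eq_zero_iff (I : Finset (Fin n)) (x : E n) : sub I x = 0 ↔ ∀ j ∈ I, x j = 0 := by
  constructor
  · intro h j hj
    have := congrArg (fun v : EuclideanSpace ℝ I => v ⟨j, hj⟩) h
    simpa using this
  · intro h
    ext j
    simpa using h j j.2

lemma sub_congr {I : Finset (Fin n)} {x y : E n} (h : ∀ j ∈ I, x j = y j) : sub I x = sub I y := by
  ext j
  exact h j j.2

lemma norm_sub_sq (I : Finset (Fin n)) (x : E n) : ‖sub I x‖ ^ 2 = ∑ j ∈ I, x j ^ 2 := by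
  rw [EuclideanSpace.norm_sq_eq, ← Finset.sum_coe_sort I]
  simp

lemma inner_sub_sub (I : Finset (Fin n)) (x y : E n) :
    inner ℝ (sub I x) (sub I y) = ∑ j ∈ I, x j * y j := by
  rw [PiLp.inner_apply, ← Finset.sum_coe_sort I]
  simp [mul_comm]

lemma inner_eq_sum (x y : E n) : inner ℝ x y = ∑ j, x j * y j := by
  rw [PiLp.inner_apply]
  simp [mul_comm]

lemma norm_sq_eq_sum (x : E n) : ‖x‖ ^ 2 = ∑ j, x j ^ 2 := by
  rw [EuclideanSpace.norm_sq_eq]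
  simp

lemma inner_proj_left (I : Finset (Fin n)) (x y : E n) :
    inner ℝ (proj I x) y = inner ℝ (sub I x) (sub I y) := by
  rw [inner_sub_sub, inner_eq_sum]
  simp [Finset.sum_ite_mem]

lemma inner_proj_right (I : Finset (Fin n)) (x y : E n) :
    inner ℝ x (proj I y) = inner ℝ (sub I x) (sub I y) := by
  rw [real_inner_comm, inner_proj_left, real_inner_comm]

lemma sub_proj (I : Finset (Fin n)) (x : E n) : sub I (proj I x) = sub I x := by
  ext j; simp

lemma norm_proj (I : Finset (Fin n)) (x : E n) : ‖proj I x‖ = ‖sub I x‖ := by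
  rw [← sq_eq_sq₀ (norm_nonneg _) (norm_nonneg _), ← real_inner_self_eq_norm_sq,
    inner_proj_left, sub_proj, real_inner_self_eq_norm_sq]

lemma norm_sub_mono {I J : Finset (Fin n)} (h : I ⊆ J) (x : E n) : ‖sub I x‖ ≤ ‖sub J x‖ := by
  rw [← sq_le_sq₀ (norm_nonneg _) (norm_nonneg _), norm_sub_sq, norm_sub_sq]
  exact Finset.sum_le_sum_of_subset_of_nonneg h fun _ _ _ => sq_nonneg _

lemma norm_sub_le (I : Finset (Fin n)) (x : E n) : ‖sub I x‖ ≤ ‖x‖ := by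
  rw [← sq_le_sq₀ (norm_nonneg _) (norm_nonneg _), norm_sub_sq, norm_sq_eq_sum]
  exact Finset.sum_le_sum_of_subset_of_nonneg (Finset.subset_univ I) fun _ _ _ => sq_nonneg _

lemma norm_le_norm_sub_add_norm_sub_compl (I : Finset (Fin n)) (x : E n) :
    ‖x‖ ≤ ‖sub I x‖ + ‖sub (Finset.univ \ I) x‖ := by
  have h : ‖x‖ ^ 2 = ‖sub I x‖ ^ 2 + ‖sub (Finset.univ \ I) x‖ ^ 2 := by
    rw [norm_sub_sq, norm_sub_sq, norm_sq_eq_sum, add_comm]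
    exact (Finset.sum_sdiff (Finset.subset_univ I)).symm
  refine le_of_sq_le_sq ?_ (by positivity)
  nlinarith [norm_nonneg (sub I x), norm_nonneg (sub (Finset.univ \ I) x)]

lemma continuous_sub (I : Finset (Fin n)) : Continuous (sub I : E n → EuclideanSpace ℝ I) := by
  unfold sub
  fun_prop

/-- `sub` as a continuous linear map. -/
noncomputable def subL (I : Finset (Fin n)) : E n →L[ℝ] EuclideanSpace ℝ I where
  toFun := sub I
  map_add' := sub_add I
  map_smul' := sub_smul I
  cont := continuous_sub I

@[simp] lemma subL_apply (I : Finset (Fin n)) (x : E n) : subL I x = sub I x := rfl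

lemma sub_pad (I : Finset (Fin n)) (v : EuclideanSpace ℝ I) : sub I (pad I v) = v := by
  ext j
  simp [pad_apply]

lemma pad_sub (I : Finset (Fin n)) (x : E n) : pad I (sub I x) = proj I x := by
  ext j
  by_cases h : j ∈ I <;> simp [pad_apply, h]

lemma norm_pad (I : Finset (Fin n)) (v : EuclideanSpace ℝ I) : ‖pad I v‖ = ‖v‖ := by
  have h : proj I (pad I v) = pad I v := by rw [← pad_sub, sub_pad]
  rw [← h, norm_proj, sub_pad]

/-- `pad` as a linear isometry. -/
noncomputable def padL (I : Finset (Fin n)) : EuclideanSpace ℝ I →ₗᵢ[ℝ] E n where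
  toFun := pad I
  map_add' v w := by
    ext j
    by_cases h : j ∈ I <;> simp [pad_apply, h]
  map_smul' a v := by
    ext j
    by_cases h : j ∈ I <;> simp [pad_apply, h]
  norm_map' := norm_pad I

@[simp] lemma padL_apply (I : Finset (Fin n)) (v : EuclideanSpace ℝ I) : padL I v = pad I v := rfl

lemma pad_add (I : Finset (Fin n)) (v w : EuclideanSpace ℝ I) :
    pad I (v + w) = pad I v + pad I w := (padL I).map_add v w

lemma pad_smul (I : Finset (Fin n)) (a : ℝ) (v : EuclideanSpace ℝ I) :
    pad I (a • v) = a • pad I v := (padL I).map_smul a v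

lemma pad_single (I : Finset (Fin n)) (j : I) :
    pad I (EuclideanSpace.single j 1) = EuclideanSpace.single (j : Fin n) 1 := by
  ext a
  by_cases h : a ∈ I
  · simp [pad_apply, h, Subtype.ext_iff]
  · have : a ≠ j := fun e => h (e ▸ j.2)
    simp [pad_apply, h, this]

lemma pad_sub_of_forall_eq_zero {I : Finset (Fin n)} {x : E n} (h : ∀ j ∉ I, x j = 0) :
    pad I (sub I x) = x := by
  rw [pad_sub]
  ext j
  by_cases hj : j ∈ I <;> simp [hj, h]

/-! ### Elementary inequalities for norms -/

/-- Equivalent to `(‖a + h‖ - ‖a‖)² ≥ 0`: away from zero the norm has curvature at most `1/‖a‖`. -/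
lemma norm_add_le_of_ne_zero {V : Type*} [NormedAddCommGroup V] [InnerProductSpace ℝ V]
    {a : V} (ha : a ≠ 0) (h : V) :
    ‖a + h‖ ≤ ‖a‖ + inner ℝ a h / ‖a‖ + ‖h‖ ^ 2 / (2 * ‖a‖) := by
  have ha' : 0 < ‖a‖ := norm_pos_iff.mpr ha
  have e := norm_add_sq_real a h
  have : ‖a‖ + inner ℝ a h / ‖a‖ + ‖h‖ ^ 2 / (2 * ‖a‖)
      = (‖a + h‖ ^ 2 + ‖a‖ ^ 2) / (2 * ‖a‖) := by
    rw [e]; field_simp; ring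
  rw [this, le_div_iff₀ (by positivity)]
  nlinarith [sq_nonneg (‖a + h‖ - ‖a‖)]

lemma norm_add_inner_div_le_norm_add {V : Type*} [NormedAddCommGroup V] [InnerProductSpace ℝ V]
    {a : V} (ha : a ≠ 0) (h : V) :
    ‖a‖ + inner ℝ a h / ‖a‖ ≤ ‖a + h‖ := by
  have ha' : 0 < ‖a‖ := norm_pos_iff.mpr ha
  have e : ‖a‖ + inner ℝ a h / ‖a‖ = inner ℝ a (a + h) / ‖a‖ := by
    rw [inner_add_right, real_inner_self_eq_norm_sq]; field_simp
  rw [e, div_le_iff₀ ha', mul_comm]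
  exact real_inner_le_norm _ _

/-! ### First-order inequalities for convex functions -/

section Convex

variable {V : Type*} [NormedAddCommGroup V] [NormedSpace ℝ V]

lemma tendsto_slope_segment {h : V → ℝ} {h' : V →L[ℝ] ℝ} {z : V}
    (hh : HasFDerivAt h h' z) (d : V) :
    Tendsto (fun t : ℝ => t⁻¹ * (h (z + t • d) - h z)) (𝓝[>] 0) (𝓝 (h' d)) := by
  have h1 : HasDerivAt (fun t : ℝ => h (z + t • d)) (h' d) 0 := hh.hasLineDerivAt d
  simpa using h1.tendsto_slope_zero_right

/-- First-order optimality, by comparing `z` with `z + t(y - z)` and letting `t → 0`. It serves both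
the proximal subproblem and the minimizer of `F`. -/
lemma sub_le_fderiv_of_isMinOn_add {h r : V → ℝ} {h' : V →L[ℝ] ℝ} {z : V}
    (hh : HasFDerivAt h h' z) (hr : ConvexOn ℝ Set.univ r)
    (hmin : IsMinOn (fun y => h y + r y) Set.univ z) (y : V) : r z - r y ≤ h' (y - z) := by
  refine ge_of_tendsto (tendsto_slope_segment hh (y - z)) ?_
  filter_upwards [Ioo_mem_nhdsGT (zero_lt_one' ℝ)] with t ht
  have h1 : h z + r z ≤ h (z + t • (y - z)) + r (z + t • (y - z)) :=
    hmin (Set.mem_univ (z + t • (y - z)))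
  have h2 := hr.2 (Set.mem_univ z) (Set.mem_univ y) (sub_nonneg.mpr ht.2.le) ht.1.le (by ring)
  have e : (1 - t) • z + t • y = z + t • (y - z) := by module
  rw [e] at h2
  simp only [smul_eq_mul] at h2
  rw [inv_mul_eq_div, le_div_iff₀ ht.1]
  nlinarith

lemma fderiv_le_sub_of_convexOn {h : V → ℝ} {h' : V →L[ℝ] ℝ} {z : V}
    (hc : ConvexOn ℝ Set.univ h) (hh : HasFDerivAt h h' z) (y : V) : h' (y - z) ≤ h y - h z := by
  refine le_of_tendsto (tendsto_slope_segment hh (y - z)) ?_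
  filter_upwards [Ioo_mem_nhdsGT (zero_lt_one' ℝ)] with t ht
  have h2 := hc.2 (Set.mem_univ z) (Set.mem_univ y) (sub_nonneg.mpr ht.2.le) ht.1.le (by ring)
  have e : (1 - t) • z + t • y = z + t • (y - z) := by module
  rw [e] at h2
  simp only [smul_eq_mul] at h2
  rw [inv_mul_eq_div, div_le_iff₀ ht.1]
  nlinarith

end Convex

namespace Problem

variable (P : Problem n m)

/-! ### Groups -/

lemma group_unique {i i' : Fin m} {j : Fin n} (h : j ∈ P.G i) (h' : j ∈ P.G i') : i = i' := by
  by_contra hne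
  exact Finset.disjoint_left.mp (P.group_disjoint i i' hne) h h'

lemma IsGroupUnion.subset_or_disjoint {P : Problem n m} {I : Finset (Fin n)}
    (hI : P.IsGroupUnion I) (i : Fin m) : P.G i ⊆ I ∨ ∀ j ∈ P.G i, j ∉ I := by
  obtain ⟨A, rfl⟩ := hI
  by_cases h : i ∈ A
  · exact Or.inl (Finset.subset_biUnion_of_mem P.G h)
  · refine Or.inr fun j hj hjA => h ?_
    obtain ⟨i', hi', hj'⟩ := Finset.mem_biUnion.mp hjA
    rwa [P.group_unique hj hj']

lemma sub_eq_of_notMem {i : Fin m} {I : Finset (Fin n)} (h : ∀ j ∈ P.G i, j ∉ I) (x d : E n) :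
    sub (P.G i) (x + proj I d) = sub (P.G i) x :=
  sub_congr fun j hj => by simp [h j hj]

lemma sub_eq_of_subset {i : Fin m} {I : Finset (Fin n)} (h : P.G i ⊆ I) (x d : E n) :
    sub (P.G i) (x + proj I d) = sub (P.G i) (x + d) :=
  sub_congr fun j hj => by simp [h hj]

/-! ### The regularizer -/

/-- The sum of the weights, a Lipschitz constant of the regularizer. -/
noncomputable def totalWeight : ℝ := ∑ i, P.weight i

lemma totalWeight_nonneg : 0 ≤ P.totalWeight := Finset.sum_nonneg fun i _ => (P.weight_pos i).le

lemma convexOn_r : ConvexOn ℝ Set.univ P.r := by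
  refine ⟨convex_univ, fun x _ y _ a b ha hb _ => ?_⟩
  simp only [r, smul_eq_mul, Finset.mul_sum, ← Finset.sum_add_distrib]
  refine Finset.sum_le_sum fun i _ => ?_
  have h := norm_add_le (a • sub (P.G i) x) (b • sub (P.G i) y)
  rw [norm_smul, norm_smul, Real.norm_of_nonneg ha, Real.norm_of_nonneg hb] at h
  rw [sub_add, sub_smul, sub_smul]
  nlinarith [P.weight_pos i]

lemma r_sub_le (x y : E n) : P.r x - P.r y ≤ P.totalWeight * ‖x - y‖ := by
  simp only [r, totalWeight, Finset.sum_mul, ← Finset.sum_sub_distrib]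
  refine Finset.sum_le_sum fun i _ => ?_
  have h1 := norm_sub_norm_le (sub (P.G i) x) (sub (P.G i) y)
  rw [← sub_sub] at h1
  have h2 := norm_sub_le (P.G i) (x - y)
  nlinarith [P.weight_pos i]

lemma continuous_r : Continuous P.r := by
  unfold r
  exact continuous_finsetSum _ fun i _ => ((continuous_sub _).norm).const_mul _

/-- Each group lies inside `I` or misses it, so the two differences agree summand by summand. -/
lemma r_separable {I : Finset (Fin n)} (hI : P.IsGroupUnion I) (x s : E n) :
    P.r (x + s) - P.r (x + s - proj I s) = P.r (x + proj I s) - P.r x := by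
  simp only [r, ← Finset.sum_sub_distrib]
  refine Finset.sum_congr rfl fun i _ => ?_
  rcases hI.subset_or_disjoint i with h | h
  · rw [sub_eq_of_subset P h, sub_congr (x := x + s - proj I s) (y := x)]
    intro j hj; simp [h hj]
  · rw [sub_eq_of_notMem P h, sub_congr (x := x + s - proj I s) (y := x + s)]
    · simp
    · intro j hj; simp [h j hj]

/-! ### Proximal gradient steps -/

variable {P}
variable {x s : E n} {α : ℝ}

/-- That is, `-(α⁻¹ s + ∇f(x))` is a subgradient of `r` at `x + s`. The later properties of proximal
steps come from this by a choice of the test point `y`. -/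
lemma IsPGStep.r_sub_le_inner (hs : P.IsPGStep x α s) (hα : 0 < α) (y : E n) :
    P.r (x + s) - P.r y ≤ inner ℝ (α⁻¹ • s + gradient P.f x) (y - (x + s)) := by
  set a := x - α • gradient P.f x with ha
  have hd : HasFDerivAt (fun y : E n => 1 / (2 * α) * ‖y - a‖ ^ 2)
      ((1 / (2 * α)) • ((2 : ℕ) • (innerSL ℝ (x + s - a)).comp (ContinuousLinearMap.id ℝ (E n))))
      (x + s) := by
    simpa using (((hasFDerivAt_id (𝕜 := ℝ) (x + s)).sub_const a).norm_sq).const_mul (1 / (2 * α))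
  have h := sub_le_fderiv_of_isMinOn_add hd P.convexOn_r hs y
  refine h.trans (le_of_eq ?_)
  have e : x + s - a = s + α • gradient P.f x := by rw [ha]; abel
  simp only [e, FunLike.coe_smul, Pi.smul_apply, smul_eq_mul, ContinuousLinearMap.comp_id,
    inner_add_left, inner_smul_left, nsmul_eq_mul]
  simp
  field_simp

/-- The test point undoes the step on `I` only; separability turns the result into a decrease for
the partial step from `x`. -/
lemma IsPGStep.inner_add_r_le (hs : P.IsPGStep x α s) (hα : 0 < α) {I : Finset (Fin n)}
    (hI : P.IsGroupUnion I) :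
    inner ℝ (gradient P.f x) (proj I s) + (P.r (x + proj I s) - P.r x)
      ≤ -(α⁻¹ * ‖proj I s‖ ^ 2) := by
  have h := hs.r_sub_le_inner hα (x + s - proj I s)
  rw [r_separable P hI] at h
  have e : x + s - proj I s - (x + s) = -proj I s := by abel
  have e2 : inner ℝ s (proj I s) = ‖proj I s‖ ^ 2 := by
    rw [inner_proj_right, real_inner_self_eq_norm_sq, norm_proj]
  rw [e, inner_neg_right, inner_add_left, inner_smul_left, e2] at h
  simp only [RCLike.conj_to_real] at h
  linarith

lemma isGroupUnion_univ : P.IsGroupUnion Finset.univ := by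
  refine ⟨Finset.univ, ?_⟩
  ext j
  simpa using P.group_cover j

lemma proj_univ (x : E n) : proj Finset.univ x = x := by
  ext j; simp

lemma IsPGStep.norm_le (hs : P.IsPGStep x α s) (hα : 0 < α) :
    ‖s‖ ≤ α * (‖gradient P.f x‖ + P.totalWeight) := by
  have h := hs.inner_add_r_le hα isGroupUnion_univ
  rw [proj_univ] at h
  have h1 := P.r_sub_le x (x + s)
  have h2 : ‖x - (x + s)‖ = ‖s‖ := by rw [sub_add_cancel_left, norm_neg]
  rw [h2] at h1
  have h3 := neg_le_of_abs_le (abs_real_inner_le_norm (gradient P.f x) s)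
  rcases (norm_nonneg s).eq_or_lt with h0 | h0
  · rw [← h0]; have := P.totalWeight_nonneg; positivity
  · have h4 : α⁻¹ * ‖s‖ ^ 2 ≤ (‖gradient P.f x‖ + P.totalWeight) * ‖s‖ := by linarith
    rw [inv_mul_eq_div, div_le_iff₀ hα] at h4
    nlinarith

/-- Block soft thresholding. If the group survived, setting it to zero would save `weight i * ‖z_i‖`
in `r`, more than the linear term can cost. -/
lemma IsPGStep.sub_add_eq_zero (hs : P.IsPGStep x α s) (hα : 0 < α) {i : Fin m}
    (hi : α⁻¹ * ‖sub (P.G i) x‖ + ‖sub (P.G i) (gradient P.f x)‖ < P.weight i) :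
    sub (P.G i) (x + s) = 0 := by
  set z := x + s with hz
  have h := hs.r_sub_le_inner hα (z - proj (P.G i) z)
  have hr : P.r z - P.r (z - proj (P.G i) z) = P.weight i * ‖sub (P.G i) z‖ := by
    simp only [r, ← Finset.sum_sub_distrib]
    rw [Finset.sum_eq_single i]
    · rw [(sub_eq_zero_iff _ (z - proj (P.G i) z)).mpr]
      · simp
      · intro j hj; simp [hj]
    · intro i' _ hne
      rw [sub_congr (x := z - proj (P.G i) z) (y := z)]
      · simp
      · intro j hj
        have : j ∉ P.G i := fun hj' => hne (P.group_unique hj hj')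
        simp [this]
    · simp
  rw [← hz, hr] at h
  have e : z - proj (P.G i) z - z = -proj (P.G i) z := by abel
  have e2 : s = z - x := by rw [hz]; abel
  rw [e, inner_neg_right, inner_proj_right, sub_add _ (α⁻¹ • s), sub_smul, inner_add_left, inner_smul_left, e2,
    sub_sub, inner_sub_left, real_inner_self_eq_norm_sq] at h
  simp only [RCLike.conj_to_real] at h
  have h1 := real_inner_le_norm (sub (P.G i) x) (sub (P.G i) z)
  have h2 := neg_le_of_abs_le (abs_real_inner_le_norm (sub (P.G i) (gradient P.f x)) (sub (P.G i) z))
  by_contra hne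
  have h0 : 0 < ‖sub (P.G i) z‖ := norm_pos_iff.mpr hne
  have hi' := mul_lt_mul_of_pos_right hi h0
  have hα' : 0 < α⁻¹ := inv_pos.mpr hα
  have h3 := mul_le_mul_of_nonneg_left h1 hα'.le
  have h4 : 0 ≤ α⁻¹ * ‖sub (P.G i) z‖ ^ 2 := by positivity
  nlinarith

/-! ### Growth of the objective and error bounds -/

variable {σ : ℝ} {xstar : E n}

/-- Strong convexity at the midpoint of `x` and `xstar`. This gives `σ/4` instead of the sharp
`σ/2`, which is harmless. -/
lemma growth (hconv : StrongConvexOn Set.univ σ P.f) (hstar : IsMinOn P.F Set.univ xstar)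
    (x : E n) : σ / 4 * ‖x - xstar‖ ^ 2 ≤ P.F x - P.F xstar := by
  have h1 := hconv.2 (Set.mem_univ x) (Set.mem_univ xstar) (by norm_num : (0 : ℝ) ≤ 1 / 2)
    (by norm_num : (0 : ℝ) ≤ 1 / 2) (by norm_num)
  have h2 := P.convexOn_r.2 (Set.mem_univ x) (Set.mem_univ xstar) (by norm_num : (0 : ℝ) ≤ 1 / 2)
    (by norm_num : (0 : ℝ) ≤ 1 / 2) (by norm_num)
  have h3 : P.F xstar ≤ P.F ((1 / 2 : ℝ) • x + (1 / 2 : ℝ) • xstar) := hstar (Set.mem_univ _)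
  simp only [F, smul_eq_mul] at *
  nlinarith

lemma gradient_inner_eq (x y : E n) : inner ℝ (gradient P.f x) y = fderiv ℝ P.f x y :=
  inner_gradient_left

/-- Up to sign, the vector on the right is a subgradient of `F` at `x + s`; pair it with `xstar - (x
+ s)` and use the growth of `F`. -/
lemma IsPGStep.dist_le (hs : P.IsPGStep x α s) (hα : 0 < α) (hf : Differentiable ℝ P.f)
    (hσ : 0 < σ) (hconv : StrongConvexOn Set.univ σ P.f) (hstar : IsMinOn P.F Set.univ xstar) :
    σ / 4 * ‖x + s - xstar‖ ≤ ‖α⁻¹ • s + (gradient P.f x - gradient P.f (x + s))‖ := by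
  set z := x + s with hz
  have h1 := hs.r_sub_le_inner hα xstar
  have hc : ConvexOn ℝ Set.univ P.f := (hconv.strictConvexOn hσ).convexOn
  have h2 := fderiv_le_sub_of_convexOn hc (hf z).hasFDerivAt xstar
  rw [← gradient_inner_eq] at h2
  have h3 := growth hconv hstar z
  have h4 := real_inner_le_norm (α⁻¹ • s + (gradient P.f x - gradient P.f z)) (xstar - z)
  rw [norm_sub_rev xstar z] at h4
  rw [inner_add_left, inner_sub_left] at h4
  rw [inner_add_left] at h1
  simp only [F] at h3
  rcases (norm_nonneg (z - xstar)).eq_or_lt with h0 | h0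
  · rw [← h0]; simp
  · have : σ / 4 * ‖z - xstar‖ * ‖z - xstar‖
        ≤ ‖α⁻¹ • s + (gradient P.f x - gradient P.f z)‖ * ‖z - xstar‖ := by
      rw [hz] at *
      nlinarith
    exact le_of_mul_le_mul_right this h0

lemma r_sub_le_inner_of_isMinOn (hf : Differentiable ℝ P.f) (hstar : IsMinOn P.F Set.univ xstar)
    (y : E n) : P.r xstar - P.r y ≤ inner ℝ (gradient P.f xstar) (y - xstar) := by
  rw [gradient_inner_eq]
  exact sub_le_fderiv_of_isMinOn_add (hf xstar).hasFDerivAt P.convexOn_r hstar y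

/-- Monotonicity of the subdifferential of `r`: add the optimality inequalities at `x + s` and at
`xstar`. It forces the steps to vanish when the iterates converge. -/
lemma IsPGStep.norm_sq_le (hs : P.IsPGStep x α s) (hα : 0 < α) (hf : Differentiable ℝ P.f)
    (hstar : IsMinOn P.F Set.univ xstar) :
    ‖s‖ ^ 2 ≤ ‖s‖ * ‖x - xstar‖ +
      α * ‖gradient P.f x - gradient P.f xstar‖ * (‖s‖ + ‖x - xstar‖) := by
  have h1 := hs.r_sub_le_inner hα xstar
  have h2 := r_sub_le_inner_of_isMinOn hf hstar (x + s)
  have e1 : xstar - (x + s) = -(s + (x - xstar)) := by abel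
  have e2 : x + s - xstar = s + (x - xstar) := by abel
  rw [e1, inner_neg_right] at h1
  rw [e2] at h2
  have h3 := neg_le_of_abs_le
    (abs_real_inner_le_norm (gradient P.f x - gradient P.f xstar) (s + (x - xstar)))
  have h4 := neg_le_of_abs_le (abs_real_inner_le_norm s (x - xstar))
  have h5 := norm_add_le s (x - xstar)
  have h6 : inner ℝ s (s + (x - xstar)) = ‖s‖ ^ 2 + inner ℝ s (x - xstar) := by
    rw [inner_add_right, real_inner_self_eq_norm_sq]
  rw [inner_add_left, inner_smul_left, h6] at h1
  rw [inner_sub_left] at h3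
  simp only [RCLike.conj_to_real] at h1
  have h7 : α⁻¹ * (‖s‖ ^ 2 + inner ℝ s (x - xstar))
      ≤ ‖gradient P.f x - gradient P.f xstar‖ * ‖s + (x - xstar)‖ := by linarith
  rw [inv_mul_eq_div, div_le_iff₀ hα] at h7
  have h8 : ‖gradient P.f x - gradient P.f xstar‖ * ‖s + (x - xstar)‖ * α
      ≤ ‖gradient P.f x - gradient P.f xstar‖ * (‖s‖ + ‖x - xstar‖) * α := by gcongr
  linarith

end Problem

lemma hasDerivAt_norm_of_ne_zero {V : Type*} [NormedAddCommGroup V] [InnerProductSpace ℝ V]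
    {u : ℝ → V} {u' : V} {t : ℝ} (hu : HasDerivAt u u' t) (h0 : u t ≠ 0) :
    HasDerivAt (fun a => ‖u a‖) (inner ℝ (u t) u' / ‖u t‖) t := by
  have h1 : ‖u t‖ ^ 2 ≠ 0 := by positivity
  have h := hu.norm_sq.sqrt h1
  simp only [Real.sqrt_sq (norm_nonneg _)] at h
  convert h using 1
  field_simp

/-! ### The reduced gradient -/

lemma gradSub_eq_sub (I : Finset (Fin n)) (h : E n → ℝ) (x : E n) :
    gradSub I h x = sub I (WithLp.toLp 2 fun j => partialD h j x) := rfl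

lemma norm_gradSub_mono {I J : Finset (Fin n)} (hIJ : I ⊆ J) (h : E n → ℝ) (x : E n) :
    ‖gradSub I h x‖ ≤ ‖gradSub J h x‖ := by
  rw [gradSub_eq_sub, gradSub_eq_sub]
  exact norm_sub_mono hIJ _

lemma inner_gradSub_sub (I : Finset (Fin n)) (h : E n → ℝ) (x d : E n) :
    inner ℝ (gradSub I h x) (sub I d) = ∑ j ∈ I, partialD h j x * d j := by
  rw [gradSub_eq_sub, inner_sub_sub]

namespace Problem

variable {P : Problem n m} {x : E n}

lemma partialD_F (hf : DifferentiableAt ℝ P.f x) {i : Fin m} {j : Fin n} (hj : j ∈ P.G i)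
    (hi : sub (P.G i) x ≠ 0) :
    partialD P.F j x = gradient P.f x j + P.weight i * (x j / ‖sub (P.G i) x‖) := by
  set e : E n := EuclideanSpace.single j 1 with he
  have h1 : HasDerivAt (fun t : ℝ => P.f (x + t • e)) (fderiv ℝ P.f x e) 0 :=
    hf.hasFDerivAt.hasLineDerivAt e
  have hline : HasDerivAt (fun t : ℝ => x + t • e) e 0 := by
    simpa using ((hasDerivAt_id (0 : ℝ)).smul_const e).const_add x
  have h2 : HasDerivAt (fun t : ℝ => P.r (x + t • e))
      (∑ i', if i' = i then P.weight i * (x j / ‖sub (P.G i) x‖) else 0) 0 := by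
    unfold r
    refine HasDerivAt.fun_sum fun i' _ => ?_
    split_ifs with h
    · subst h
      have h3 : HasDerivAt (fun t : ℝ => sub (P.G i') (x + t • e)) (sub (P.G i') e) 0 :=
        (subL (P.G i')).hasFDerivAt.comp_hasDerivAt (0 : ℝ) hline
      have h4 := (hasDerivAt_norm_of_ne_zero h3 (by simpa using hi)).const_mul (P.weight i')
      have h5 : inner ℝ (sub (P.G i') x) (sub (P.G i') e) = x j := by
        rw [inner_sub_sub]
        simp [he, hj]
      rw [zero_smul, add_zero, h5] at h4
      exact h4
    · have hc : ∀ t : ℝ, sub (P.G i') (x + t • e) = sub (P.G i') x := fun t =>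
        sub_congr fun j' hj' => by
          have : j' ≠ j := by
            rintro rfl
            exact h (P.group_unique hj' hj)
          simp [he, this]
      simp only [hc]
      exact hasDerivAt_const _ _
  have h5 : HasLineDerivAt ℝ P.F (fderiv ℝ P.f x e + P.weight i * (x j / ‖sub (P.G i) x‖)) x e := by
    have := h1.add h2
    rw [Finset.sum_ite_eq' Finset.univ i, if_pos (Finset.mem_univ i)] at this
    exact this
  have h6 : fderiv ℝ P.f x e = gradient P.f x j := by
    rw [← gradient_inner_eq, he, EuclideanSpace.inner_single_right]
    simp
  rw [partialD, h5.lineDeriv, h6]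

section GroupUnion

variable {A : Finset (Fin m)}

lemma sum_biUnion_group (φ : Fin n → ℝ) :
    ∑ j ∈ A.biUnion P.G, φ j = ∑ i ∈ A, ∑ j ∈ P.G i, φ j :=
  Finset.sum_biUnion fun i _ i' _ h => P.group_disjoint i i' h

lemma inner_gradSub (hf : DifferentiableAt ℝ P.f x) (hA : ∀ i ∈ A, sub (P.G i) x ≠ 0) (d : E n) :
    inner ℝ (gradSub (A.biUnion P.G) P.F x) (sub (A.biUnion P.G) d)
      = inner ℝ (gradient P.f x) (proj (A.biUnion P.G) d)
        + ∑ i ∈ A, P.weight i * (inner ℝ (sub (P.G i) x) (sub (P.G i) d) / ‖sub (P.G i) x‖) := by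
  rw [inner_gradSub_sub, inner_proj_right, inner_sub_sub, sum_biUnion_group, sum_biUnion_group,
    ← Finset.sum_add_distrib]
  refine Finset.sum_congr rfl fun i hi => ?_
  rw [inner_sub_sub, Finset.sum_div, Finset.mul_sum, ← Finset.sum_add_distrib]
  refine Finset.sum_congr rfl fun j hj => ?_
  rw [partialD_F hf hj (hA i hi)]
  ring

lemma r_add_proj_biUnion (d : E n) :
    P.r (x + proj (A.biUnion P.G) d) - P.r x
      = ∑ i ∈ A, P.weight i * (‖sub (P.G i) x + sub (P.G i) d‖ - ‖sub (P.G i) x‖) := by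
  have h : ∀ i, P.weight i * ‖sub (P.G i) (x + proj (A.biUnion P.G) d)‖
      - P.weight i * ‖sub (P.G i) x‖
      = if i ∈ A then P.weight i * (‖sub (P.G i) x + sub (P.G i) d‖ - ‖sub (P.G i) x‖) else 0 := by
    intro i
    split_ifs with hi
    · rw [sub_eq_of_subset P (Finset.subset_biUnion_of_mem P.G hi), sub_add]
      ring
    · rw [sub_eq_of_notMem P, sub_self]
      intro j hj hjA
      obtain ⟨i', hi', hj'⟩ := Finset.mem_biUnion.mp hjA
      exact hi (P.group_unique hj hj' ▸ hi')
  simp only [r, ← Finset.sum_sub_distrib, h, Finset.sum_ite_mem, Finset.univ_inter]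

end GroupUnion

variable {I : Finset (Fin n)}

/-- The linearization of the convex function `r` lies below `r`. -/
lemma inner_gradSub_le (hf : DifferentiableAt ℝ P.f x) (hI : P.IsGroupUnion I)
    (hne : ∀ i, P.G i ⊆ I → sub (P.G i) x ≠ 0) (d : E n) :
    inner ℝ (gradSub I P.F x) (sub I d)
      ≤ inner ℝ (gradient P.f x) (proj I d) + (P.r (x + proj I d) - P.r x) := by
  obtain ⟨A, rfl⟩ := hI
  have hA : ∀ i ∈ A, sub (P.G i) x ≠ 0 := fun i hi => hne i (Finset.subset_biUnion_of_mem P.G hi)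
  rw [inner_gradSub hf hA, r_add_proj_biUnion]
  gcongr with i hi
  · exact (P.weight_pos i).le
  · linarith [norm_add_inner_div_le_norm_add (hA i hi) (sub (P.G i) d)]

/-- Counterpart of `inner_gradSub_le`: at distance `δ` from the kinks the linearization error of `r`
is quadratic. -/
lemma r_add_proj_le (hf : DifferentiableAt ℝ P.f x) (hI : P.IsGroupUnion I) {δ : ℝ} (hδ : 0 < δ)
    (hne : ∀ i, P.G i ⊆ I → δ ≤ ‖sub (P.G i) x‖) (d : E n) :
    inner ℝ (gradient P.f x) (proj I d) + (P.r (x + proj I d) - P.r x)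
      ≤ inner ℝ (gradSub I P.F x) (sub I d) + P.totalWeight / (2 * δ) * ‖sub I d‖ ^ 2 := by
  obtain ⟨A, rfl⟩ := hI
  have hsub : ∀ i ∈ A, P.G i ⊆ A.biUnion P.G := fun i hi => Finset.subset_biUnion_of_mem P.G hi
  have hA : ∀ i ∈ A, sub (P.G i) x ≠ 0 := fun i hi =>
    norm_pos_iff.mp (hδ.trans_le (hne i (hsub i hi)))
  rw [inner_gradSub hf hA, r_add_proj_biUnion, add_assoc, add_le_add_iff_left]
  have h1 : ∑ i ∈ A, P.weight i * (‖sub (A.biUnion P.G) d‖ ^ 2 / (2 * δ))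
      ≤ P.totalWeight / (2 * δ) * ‖sub (A.biUnion P.G) d‖ ^ 2 := by
    rw [← Finset.sum_mul]
    have : ∑ i ∈ A, P.weight i ≤ P.totalWeight :=
      Finset.sum_le_sum_of_subset_of_nonneg (Finset.subset_univ A) fun i _ _ => (P.weight_pos i).le
    calc _ ≤ P.totalWeight * (‖sub (A.biUnion P.G) d‖ ^ 2 / (2 * δ)) := by gcongr
      _ = _ := by ring
  refine le_trans ?_ (add_le_add_right h1 _)
  rw [← Finset.sum_add_distrib]
  refine Finset.sum_le_sum fun i hi => ?_
  rw [← mul_add]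
  refine mul_le_mul_of_nonneg_left ?_ (P.weight_pos i).le
  have h2 := norm_add_le_of_ne_zero (hA i hi) (sub (P.G i) d)
  have h3 : ‖sub (P.G i) d‖ ^ 2 / (2 * ‖sub (P.G i) x‖)
      ≤ ‖sub (A.biUnion P.G) d‖ ^ 2 / (2 * δ) := by
    gcongr
    · exact norm_sub_mono (hsub i hi) d
    · exact hne i (hsub i hi)
  linarith

/-- The test direction is the reduced gradient itself; `r` is Lipschitz with constant `totalWeight`.
-/
lemma norm_gradSub_le (hf : DifferentiableAt ℝ P.f x) (hI : P.IsGroupUnion I)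
    (hne : ∀ i, P.G i ⊆ I → sub (P.G i) x ≠ 0) :
    ‖gradSub I P.F x‖ ≤ ‖gradient P.f x‖ + P.totalWeight := by
  set g := gradSub I P.F x with hg
  have h := inner_gradSub_le hf hI hne (pad I g)
  rw [sub_pad, ← hg, real_inner_self_eq_norm_sq] at h
  have h1 := P.r_sub_le (x + proj I (pad I g)) x
  have h2 := real_inner_le_norm (gradient P.f x) (proj I (pad I g))
  have h3 : ‖proj I (pad I g)‖ = ‖g‖ := by rw [norm_proj, sub_pad]
  rw [add_sub_cancel_left, h3] at h1
  rw [h3] at h2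
  rcases (norm_nonneg g).eq_or_lt with h0 | h0
  · rw [← h0]
    have := P.totalWeight_nonneg
    positivity
  · nlinarith

/-- The proximal decrease is at least `α⁻¹‖s_I‖²`, while the linearization allows at most `‖∇_I
F‖‖s_I‖`. Thus a small reduced gradient makes `χcg` small. -/
lemma IsPGStep.norm_sub_le_gradSub {s : E n} {α : ℝ} (hs : P.IsPGStep x α s) (hα : 0 < α)
    (hf : DifferentiableAt ℝ P.f x) (hI : P.IsGroupUnion I)
    (hne : ∀ i, P.G i ⊆ I → sub (P.G i) x ≠ 0) :
    ‖sub I s‖ ≤ α * ‖gradSub I P.F x‖ := by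
  have h1 := hs.inner_add_r_le hα hI
  have h2 := inner_gradSub_le hf hI hne s
  have h3 := neg_le_of_abs_le (abs_real_inner_le_norm (gradSub I P.F x) (sub I s))
  rw [norm_proj] at h1
  rcases (norm_nonneg (sub I s)).eq_or_lt with h0 | h0
  · rw [← h0]; positivity
  · have h4 : α⁻¹ * ‖sub I s‖ ^ 2 ≤ ‖gradSub I P.F x‖ * ‖sub I s‖ := by linarith
    rw [inv_mul_eq_div, div_le_iff₀ hα] at h4
    nlinarith

/-! ### The index sets -/

lemma isGroupUnion_of_forall (h : ∀ i, P.G i ⊆ I ∨ ∀ j ∈ P.G i, j ∉ I) : P.IsGroupUnion I := by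
  classical
  refine ⟨Finset.univ.filter fun i => P.G i ⊆ I, ?_⟩
  ext j
  simp only [Finset.mem_biUnion, Finset.mem_filter, Finset.mem_univ, true_and]
  constructor
  · intro hj
    obtain ⟨i, hi⟩ := P.group_cover j
    exact ⟨i, (h i).resolve_right fun h' => h' j hi hj, hi⟩
  · rintro ⟨i, hi, hj⟩
    exact hi hj

variable {c : Constants} {s : E n}

lemma mem_IcgBar {i : Fin m} {j : Fin n} (hj : j ∈ P.G i) :
    j ∈ P.IcgBar c x s ↔ sub (P.G i) x ≠ 0 ∧ sub (P.G i) (x + s) ≠ 0 ∧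
      c.κ₁ * ‖gradSub (P.G i) P.F x‖ ≤ ‖sub (P.G i) x‖ := by
  simp only [IcgBar, Finset.mem_filter, Finset.mem_univ, true_and]
  constructor
  · rintro ⟨i', hj', h⟩
    rwa [P.group_unique hj hj']
  · exact fun h => ⟨i, hj, h⟩

lemma mem_Icg {i : Fin m} {j : Fin n} (hj : j ∈ P.G i) :
    j ∈ P.Icg c x s ↔ (sub (P.G i) x ≠ 0 ∧ sub (P.G i) (x + s) ≠ 0 ∧
      c.κ₁ * ‖gradSub (P.G i) P.F x‖ ≤ ‖sub (P.G i) x‖) ∧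
      c.κ₂ * ‖gradSub (P.IcgBar c x s) P.F x‖ ^ c.p ≤ ‖sub (P.G i) x‖ := by
  rw [Icg, Finset.mem_sdiff, mem_IcgBar hj]
  refine and_congr_right fun h => ?_
  simp only [Ismall, Finset.mem_filter, Finset.mem_univ, true_and, not_exists, not_and, not_lt]
  constructor
  · exact fun h' => h' i hj fun j' hj' => (mem_IcgBar hj').mpr h
  · intro h' i' hj' _
    rwa [← P.group_unique hj hj']

lemma isGroupUnion_Icg : P.IsGroupUnion (P.Icg c x s) := by
  refine isGroupUnion_of_forall fun i => ?_
  by_cases h : ∃ j ∈ P.G i, j ∈ P.Icg c x s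
  · obtain ⟨j, hj, hj'⟩ := h
    exact Or.inl fun a ha => (mem_Icg ha).mpr ((mem_Icg hj).mp hj')
  · push Not at h
    exact Or.inr h

lemma sub_ne_zero_of_subset_Icg {i : Fin m} (hi : P.G i ⊆ P.Icg c x s) : sub (P.G i) x ≠ 0 := by
  obtain ⟨j, hj⟩ := P.group_nonempty i
  exact ((mem_Icg hj).mp (hi hj)).1.1

/-- `Ismall` is measured with the gradient over the larger set `IcgBar`, so the bound survives the
passage to `Icg`. It keeps the groups off the kinks while the reduced gradient is not small. -/
lemma gradSub_rpow_le_of_subset_Icg {i : Fin m} (hi : P.G i ⊆ P.Icg c x s) :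
    c.κ₂ * ‖gradSub (P.Icg c x s) P.F x‖ ^ c.p ≤ ‖sub (P.G i) x‖ := by
  obtain ⟨j, hj⟩ := P.group_nonempty i
  refine le_trans ?_ ((mem_Icg hj).mp (hi hj)).2
  have h1 : ‖gradSub (P.Icg c x s) P.F x‖ ≤ ‖gradSub (P.IcgBar c x s) P.F x‖ :=
    norm_gradSub_mono Finset.sdiff_subset _ _
  have h2 := c.κ₂_pos
  have h3 := c.p_pos
  gcongr

/-! ### The step sizes `τ` -/

variable {d : E n}

lemma le_τgroup {T : ℝ} (hT : 0 < T) {i : Fin m}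
    (h : ∀ t : ℝ, 0 ≤ t → t ≤ T → P.ρbar c x s i < ‖sub (P.G i) (x + t • d)‖) :
    (T : EReal) ≤ P.τgroup c x s d i := by
  unfold τgroup
  split_ifs with h0
  · exact le_top
  · push Not at h0
    obtain ⟨t₀, ht₀, hle⟩ := h0
    have hcont : ContinuousOn (fun t : ℝ => ‖sub (P.G i) (x + t • d)‖) (Set.Icc 0 t₀) := by
      have := continuous_sub (P.G i)
      fun_prop
    have h00 := h 0 le_rfl hT.le
    -- This root makes the set of positive roots nonempty; for an empty set `sInf` would take the
    -- default value 0.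
    obtain ⟨t, ht, hteq⟩ := intermediate_value_Icc' ht₀ hcont ⟨hle, h00.le⟩
    have htpos : 0 < t := by
      rcases ht.1.eq_or_lt with e | e
      · subst e
        exact absurd hteq h00.ne'
      · exact e
    rw [EReal.coe_le_coe_iff]
    refine le_csInf ⟨t, htpos, hteq⟩ ?_
    rintro b ⟨hb, hbeq⟩
    by_contra! hlt
    exact (h b hb.le hlt.le).ne' hbeq

lemma le_τmin {T : ℝ} (hT : 0 < T)
    (h : ∀ i, P.G i ⊆ I → ∀ t : ℝ, 0 ≤ t → t ≤ T →
      P.ρbar c x s i < ‖sub (P.G i) (x + t • d)‖) :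
    (T : EReal) ≤ P.τmin c x s d I := by
  classical
  unfold τmin
  refine Finset.le_inf fun i hi => le_τgroup hT (h i ?_)
  simpa using hi

lemma sin_θ_mem (c : Constants) : Real.sin c.θ ∈ Set.Ioo 0 1 := by
  have h := c.θ_mem
  refine ⟨Real.sin_pos_of_pos_of_lt_pi h.1 (by linarith [h.2, Real.pi_pos]), ?_⟩
  rw [← Real.sin_pi_div_two]
  exact Real.sin_lt_sin_of_lt_of_le_pi_div_two (by linarith [h.1, Real.pi_pos]) le_rfl h.2

/-- The radius is at most `sin θ * ‖[x]_{Gᵢ}‖`, so the ray has to travel at least `(1 - sin θ) *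
‖[x]_{Gᵢ}‖` to reach the ball. -/
lemma le_τmin_of_norm_le {T : ℝ} (hT : 0 < T)
    (h : ∀ i, P.G i ⊆ I → T * ‖d‖ < (1 - Real.sin c.θ) * ‖sub (P.G i) x‖) : (T : EReal) ≤ P.τmin c x s d I := by
  refine le_τmin hT fun i hi t ht0 htT => ?_
  have h1 : P.ρbar c x s i ≤ Real.sin c.θ * ‖sub (P.G i) x‖ := min_le_right _ _
  have h2 : ‖sub (P.G i) x‖ - t * ‖sub (P.G i) d‖ ≤ ‖sub (P.G i) (x + t • d)‖ := by
    have h3 := norm_sub_norm_le (sub (P.G i) x) (-(t • sub (P.G i) d))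
    rw [norm_neg, norm_smul, Real.norm_of_nonneg ht0, sub_neg_eq_add] at h3
    rwa [sub_add, sub_smul]
  have h4 : t * ‖sub (P.G i) d‖ ≤ T * ‖d‖ :=
    mul_le_mul htT (norm_sub_le _ _) (norm_nonneg _) hT.le
  linarith [h i hi]

end Problem

/-! ### Directions from the subproblem solver -/

section Direction

variable {ι : Type} [Fintype ι] {g d : EuclideanSpace ℝ ι} {H : Matrix ι ι ℝ} {μ q a b : ℝ}

/-- A nonpositive model value gives `(a/2)‖d‖² ≤ -gᵀd ≤ ‖g‖‖d‖`. -/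
lemma IsCGDirection.norm_le (hd : IsCGDirection g H μ q d) (ha : 0 < a)
    (hH : ∀ v : EuclideanSpace ℝ ι, a * ‖v‖ ^ 2 ≤ inner ℝ v (mulV H v)) : ‖d‖ ≤ 2 * ‖g‖ / a := by
  have h1 := hd.2.1
  have h0 : model g H 0 = 0 := by simp [model]
  rw [h0, model] at h1
  have h2 := hH d
  have h3 := neg_le_of_abs_le (abs_real_inner_le_norm g d)
  rw [le_div_iff₀ ha]
  rcases (norm_nonneg d).eq_or_lt with h | h
  · rw [← h]; simp
  · nlinarith

/-- The reference direction has slope `-‖g‖⁴/(gᵀHg)`. -/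
lemma IsCGDirection.inner_le (hd : IsCGDirection g H μ q d) (ha : 0 < a)
    (hH : ∀ v : EuclideanSpace ℝ ι, a * ‖v‖ ^ 2 ≤ inner ℝ v (mulV H v) ∧
      inner ℝ v (mulV H v) ≤ b * ‖v‖ ^ 2) : inner ℝ g d ≤ -(‖g‖ ^ 2 / b) := by
  refine hd.1.trans ?_
  by_cases hg : g = 0
  · simp [hg]
  have hgp : 0 < ‖g‖ := norm_pos_iff.mpr hg
  have h1 := hH g
  have h2 : 0 < inner ℝ g (mulV H g) := lt_of_lt_of_le (by positivity) h1.1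
  have hb : 0 < b := by
    by_contra! hb
    nlinarith [sq_nonneg ‖g‖]
  rw [refDir, inner_neg_right, inner_smul_right, real_inner_self_eq_norm_sq, neg_le_neg_iff,
    div_mul_eq_mul_div, div_le_div_iff₀ hb h2]
  nlinarith [sq_nonneg ‖g‖]

end Direction

/-! ### Smooth functions on balls -/

lemma contDiff_gradient {f : E n → ℝ} (hf : ContDiff ℝ 2 f) : ContDiff ℝ 1 (gradient f) :=
  (InnerProductSpace.toDual ℝ (E n)).symm.contDiff.comp (hf.fderiv_right (m := 1) (by norm_num))

lemma exists_lipschitz_gradient {f : E n → ℝ} (hf : ContDiff ℝ 2 f) (R : ℝ) :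
    ∃ L : ℝ, 0 < L ∧ ∀ x y : E n, ‖x‖ ≤ R → ‖y‖ ≤ R →
      ‖gradient f x - gradient f y‖ ≤ L * ‖x - y‖ := by
  obtain ⟨K, hK⟩ := (contDiff_gradient hf).contDiffOn.exists_lipschitzOnWith (n := 1) one_ne_zero
    (convex_closedBall (0 : E n) R) (isCompact_closedBall (0 : E n) R)
  refine ⟨K + 1, by positivity, fun x y hx hy => ?_⟩
  have h := hK.dist_le_mul x (by simpa using hx) y (by simpa using hy)
  rw [dist_eq_norm, dist_eq_norm] at h
  nlinarith [norm_nonneg (x - y)]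

/-- The mean value inequality yields `L` instead of the sharp `L/2`, which suffices. -/
lemma descent {f : E n → ℝ} (hf : Differentiable ℝ f) {R L : ℝ}
    (hL : ∀ x y : E n, ‖x‖ ≤ R → ‖y‖ ≤ R → ‖gradient f x - gradient f y‖ ≤ L * ‖x - y‖)
    (hL0 : 0 < L) {x d : E n} (hx : ‖x‖ ≤ R) (hxd : ‖x + d‖ ≤ R) :
    f (x + d) ≤ f x + inner ℝ (gradient f x) d + L * ‖d‖ ^ 2 := by
  have hseg : segment ℝ x (x + d) ⊆ Metric.closedBall 0 R :=
    (convex_closedBall 0 R).segment_subset (by simpa using hx) (by simpa using hxd)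
  have h := (convex_segment x (x + d)).norm_image_sub_le_of_norm_hasFDerivWithin_le'
    (f := f) (f' := fderiv ℝ f) (φ := fderiv ℝ f x) (C := L * ‖d‖)
    (fun y _ => (hf y).hasFDerivAt.hasFDerivWithinAt) (fun y hy => ?_)
    (left_mem_segment ℝ x (x + d)) (right_mem_segment ℝ x (x + d))
  · rw [add_sub_cancel_left, Real.norm_eq_abs] at h
    have h1 := le_of_abs_le h
    rw [inner_gradient_left]
    nlinarith
  · have h1 : ‖fderiv ℝ f y - fderiv ℝ f x‖ = ‖gradient f y - gradient f x‖ := by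
      rw [← toDual_gradient, ← toDual_gradient, ← map_sub, LinearIsometryEquiv.norm_map]
    rw [h1]
    have hyR : ‖y‖ ≤ R := by simpa using hseg hy
    refine (hL y x hyR hx).trans ?_
    have : ‖y - x‖ ≤ ‖d‖ := by
      have := norm_sub_le_of_mem_segment hy
      simpa using this
    gcongr

lemma tendsto_sub_succ_of_antitone {u : ℕ → ℝ} (hu : Antitone u) {b : ℝ} (hb : ∀ k, b ≤ u k) :
    Tendsto (fun k => u k - u (k + 1)) atTop (𝓝 0) := by
  have h := tendsto_atTop_ciInf hu ⟨b, by rintro _ ⟨k, rfl⟩; exact hb k⟩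
  simpa using h.sub (h.comp (tendsto_add_atTop_nat 1))

/-! ### Runs of the algorithm under the standing assumptions -/

namespace Trace

/-- The standing assumptions of the convergence analysis. -/
structure IsRegularRun (t : Trace n) (P : Problem n m) (c : Constants) (xstar : E n)
    (σ a b : ℝ) : Prop where
  contDiff : ContDiff ℝ 2 P.f
  σ_pos : 0 < σ
  convex : StrongConvexOn Set.univ σ P.f
  isMin : IsMinOn P.F Set.univ xstar
  run : t.IsRun P c
  a_pos : 0 < a
  a_le_b : a ≤ b
  H_bound : ∀ k ∈ t.Kcg P c, ∀ v : EuclideanSpace ℝ (t.I k),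
    a * ‖v‖ ^ 2 ≤ inner ℝ v (mulV (t.H k) v) ∧ inner ℝ v (mulV (t.H k) v) ≤ b * ‖v‖ ^ 2

namespace IsRegularRun

variable {t : Trace n} {P : Problem n m} {c : Constants} {xstar : E n} {σ a b : ℝ}

lemma differentiable (h : t.IsRegularRun P c xstar σ a b) : Differentiable ℝ P.f :=
  h.contDiff.differentiable (by norm_num)

lemma b_pos (h : t.IsRegularRun P c xstar σ a b) : 0 < b := h.a_pos.trans_le h.a_le_b

lemma continuous_gradient (h : t.IsRegularRun P c xstar σ a b) : Continuous (gradient P.f) :=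
  (contDiff_gradient h.contDiff).continuous

lemma continuous_F (h : t.IsRegularRun P c xstar σ a b) : Continuous P.F :=
  h.contDiff.continuous.add P.continuous_r

/-! ### Monotonicity and boundedness -/

/-- In a subspace step the next iterate comes either from the projected phase or from an Armijo
search. -/
lemma cg_cases (h : t.IsRegularRun P c xstar σ a b) {k : ℕ} (hk : k ∈ t.Kcg P c) :
    ∃ j : ℕ, (∀ j' < j, ¬ P.cgAccept c (t.x k) (t.s k) (pad (t.I k) (t.dbar k)) (t.I k) j') ∧
      t.x (k + 1) = P.cgTrial c (t.x k) (t.s k) (pad (t.I k) (t.dbar k)) (t.I k) j ∧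
      ((P.τmin c (t.x k) (t.s k) (pad (t.I k) (t.dbar k)) (t.I k) ≤ ((c.ξ ^ j : ℝ) : EReal) ∧
        P.F (t.x (k + 1)) ≤ P.F (t.x k)) ∨
      (¬ P.τmin c (t.x k) (t.s k) (pad (t.I k) (t.dbar k)) (t.I k) ≤ ((c.ξ ^ j : ℝ) : EReal) ∧
        P.F (t.x (k + 1)) ≤ P.F (t.x k)
          + c.η * c.ξ ^ j * inner ℝ (gradSub (t.I k) P.F (t.x k)) (t.dbar k))) := by
  obtain ⟨j, hj, hx⟩ := (h.run.cg k hk).x_next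
  refine ⟨j, fun j' hlt hacc => hlt.not_ge (hj.2 hacc), hx, ?_⟩
  have hacc : P.cgAccept c (t.x k) (t.s k) (pad (t.I k) (t.dbar k)) (t.I k) j := hj.1
  rw [Problem.cgAccept] at hacc
  rw [hx]
  split_ifs at hacc with hτ
  · exact Or.inl ⟨hτ, hacc⟩
  · rw [sub_pad] at hacc
    exact Or.inr ⟨hτ, hacc⟩

lemma inner_dbar_le (h : t.IsRegularRun P c xstar σ a b) {k : ℕ} (hk : k ∈ t.Kcg P c) :
    inner ℝ (gradSub (t.I k) P.F (t.x k)) (t.dbar k)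
      ≤ -(‖gradSub (t.I k) P.F (t.x k)‖ ^ 2 / b) :=
  (h.run.cg k hk).direction.inner_le h.a_pos (h.H_bound k hk)

lemma inner_dbar_nonpos (h : t.IsRegularRun P c xstar σ a b) {k : ℕ} (hk : k ∈ t.Kcg P c) :
    inner ℝ (gradSub (t.I k) P.F (t.x k)) (t.dbar k) ≤ 0 := by
  have := h.b_pos
  exact (h.inner_dbar_le hk).trans (neg_nonpos.mpr (by positivity))

lemma α_mem (h : t.IsRegularRun P c xstar σ a b) (k : ℕ) : t.α k ∈ Set.Ioc 0 1 := by
  induction k with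
  | zero => exact h.run.α_zero
  | succ k ih =>
    by_cases hk : k ∈ t.Kcg P c
    · rwa [(h.run.cg k hk).α_next]
    · obtain ⟨j, _, _, hα⟩ := (h.run.pg k hk).next
      rw [hα]
      split_ifs
      · exact ih
      · have h1 := c.ζ_mem
        exact ⟨mul_pos h1.1 ih.1, mul_le_one₀ h1.2.le ih.1.le ih.2⟩

lemma F_antitone (h : t.IsRegularRun P c xstar σ a b) : Antitone fun k => P.F (t.x k) := by
  refine antitone_nat_of_succ_le fun k => ?_
  have hη := c.η_mem
  have hξ := c.ξ_mem
  by_cases hk : k ∈ t.Kcg P c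
  · obtain ⟨j, _, _, ⟨_, hF⟩ | ⟨_, hF⟩⟩ := h.cg_cases hk
    · exact hF
    · have h1 : 0 ≤ c.η * c.ξ ^ j := mul_nonneg hη.1.le (pow_nonneg hξ.1.le j)
      nlinarith [h.inner_dbar_nonpos hk]
  · obtain ⟨j, hj, hx, _⟩ := (h.run.pg k hk).next
    have hacc : P.pgAccept c (t.x k) (t.s k) (t.α k) (t.I k) j := hj.1
    rw [Problem.pgAccept, ← hx] at hacc
    have h1 : 0 ≤ c.η * c.ξ ^ j * (1 / t.α k) * ‖proj (t.I k) (t.s k)‖ ^ 2 := by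
      have h2 := (h.α_mem k).1
      have h3 := hη.1
      have h4 := hξ.1
      positivity
    linarith

lemma F_ge (h : t.IsRegularRun P c xstar σ a b) (x : E n) : P.F xstar ≤ P.F x :=
  h.isMin (Set.mem_univ x)

lemma exists_norm_le (h : t.IsRegularRun P c xstar σ a b) : ∃ R : ℝ, 0 ≤ R ∧ ∀ k, ‖t.x k‖ ≤ R := by
  refine ⟨‖xstar‖ + (1 + 4 / σ * (P.F (t.x 0) - P.F xstar)), ?_, fun k => ?_⟩
  · have h1 := sub_nonneg.mpr (h.F_ge (t.x 0))
    have h2 := h.σ_pos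
    positivity
  · have h1 := Problem.growth h.convex h.isMin (t.x k)
    have h2 : P.F (t.x k) ≤ P.F (t.x 0) := h.F_antitone (Nat.zero_le k)
    have h3 : ‖t.x k‖ ≤ ‖xstar‖ + ‖t.x k - xstar‖ := by
      simpa [add_comm] using norm_le_norm_add_norm_sub' (t.x k) xstar
    have h4 : ‖t.x k - xstar‖ ^ 2 ≤ 4 / σ * (P.F (t.x 0) - P.F xstar) := by
      rw [div_mul_eq_mul_div, le_div_iff₀ h.σ_pos]
      linarith
    nlinarith [sq_nonneg (‖t.x k - xstar‖ - 1)]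

lemma exists_gradient_le (h : t.IsRegularRun P c xstar σ a b) :
    ∃ M : ℝ, 0 ≤ M ∧ ∀ k, ‖gradient P.f (t.x k)‖ ≤ M := by
  obtain ⟨R, _, hR⟩ := h.exists_norm_le
  obtain ⟨M, hM⟩ := (isCompact_closedBall (0 : E n) R).exists_bound_of_continuousOn
    h.continuous_gradient.continuousOn
  exact ⟨M, (norm_nonneg _).trans (hM (t.x 0) (by simpa using hR 0)),
    fun k => hM _ (by simpa using hR k)⟩

lemma tendsto_F_sub (h : t.IsRegularRun P c xstar σ a b) :
    Tendsto (fun k => P.F (t.x k) - P.F (t.x (k + 1))) atTop (𝓝 0) :=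
  tendsto_sub_succ_of_antitone h.F_antitone fun k => h.F_ge (t.x k)

/-! ### The proximal parameter -/

lemma norm_s_le (h : t.IsRegularRun P c xstar σ a b) {M : ℝ}
    (hM : ∀ k, ‖gradient P.f (t.x k)‖ ≤ M) (k : ℕ) : ‖t.s k‖ ≤ M + P.totalWeight := by
  have hα := h.α_mem k
  have h1 := (h.run.pgStep k).norm_le hα.1
  have h2 : 0 ≤ ‖gradient P.f (t.x k)‖ + P.totalWeight :=
    add_nonneg (norm_nonneg _) P.totalWeight_nonneg
  nlinarith [hM k, hα.2]

/-- For `α ≤ (1 - η)/L` the error `L‖·‖²` of the descent inequality is absorbed by the unused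
fraction `(1 - η)/α` of the proximal decrease, so `j = 0` passes. -/
lemma α_next_of_small (h : t.IsRegularRun P c xstar σ a b) :
    ∃ r : ℝ, 0 < r ∧ ∀ k, t.α k ≤ r → t.α (k + 1) = t.α k := by
  obtain ⟨R, hR0, hR⟩ := h.exists_norm_le
  obtain ⟨M, hM0, hM⟩ := h.exists_gradient_le
  obtain ⟨L, hL0, hL⟩ := exists_lipschitz_gradient h.contDiff (R + (M + P.totalWeight))
  have hη := c.η_mem
  refine ⟨(1 - c.η) / L, div_pos (by linarith [hη.2]) hL0, fun k hk => ?_⟩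
  by_cases hkc : k ∈ t.Kcg P c
  · exact (h.run.cg k hkc).α_next
  obtain ⟨j, hj, -, hα⟩ := (h.run.pg k hkc).next
  suffices P.pgAccept c (t.x k) (t.s k) (t.α k) (t.I k) 0 by
    have h0 : j = 0 := Nat.le_zero.mp (hj.2 this)
    rw [hα, if_pos h0]
  have hαp := (h.α_mem k).1
  have hs := h.norm_s_le hM k
  have hp : ‖proj (t.I k) (t.s k)‖ ≤ ‖t.s k‖ := by
    rw [norm_proj]; exact norm_sub_le _ _
  have h1 := descent h.differentiable hL hL0 (x := t.x k) (d := proj (t.I k) (t.s k))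
    ((hR k).trans (by linarith [norm_nonneg (t.s k)]))
    ((norm_add_le _ _).trans (add_le_add (hR k) (hp.trans hs)))
  have h2 := (h.run.pgStep k).inner_add_r_le hαp (h.run.pg k hkc).union
  rw [le_div_iff₀ hL0] at hk
  have h3 : L ≤ (1 - c.η) * (t.α k)⁻¹ := by
    rw [← div_eq_mul_inv, le_div_iff₀ hαp]; linarith
  have h4 := mul_le_mul_of_nonneg_right h3 (sq_nonneg ‖proj (t.I k) (t.s k)‖)
  simp only [Problem.pgAccept, pow_zero, one_smul, mul_one, one_div, Problem.F]
  nlinarith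

/-- A reduction occurs only above the threshold `r`, so it leaves a value above `ζ r`. -/
lemma exists_α_ge (h : t.IsRegularRun P c xstar σ a b) : ∃ r : ℝ, 0 < r ∧ ∀ k, r ≤ t.α k := by
  obtain ⟨r, hr, hα⟩ := h.α_next_of_small
  have hζ := c.ζ_mem
  refine ⟨min (t.α 0) (c.ζ * r), lt_min (h.α_mem 0).1 (mul_pos hζ.1 hr), fun k => ?_⟩
  induction k with
  | zero => exact min_le_left _ _
  | succ k ih =>
    by_cases hk : t.α k ≤ r
    · rwa [hα k hk]
    · push Not at hk
      by_cases hkc : k ∈ t.Kcg P c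
      · rwa [(h.run.cg k hkc).α_next]
      · obtain ⟨j, -, -, hnext⟩ := (h.run.pg k hkc).next
        rw [hnext]
        split_ifs
        · exact ih
        · exact (min_le_right _ _).trans (by nlinarith [hζ.1])

lemma α_antitone (h : t.IsRegularRun P c xstar σ a b) : Antitone t.α := by
  refine antitone_nat_of_succ_le fun k => ?_
  by_cases hkc : k ∈ t.Kcg P c
  · exact (h.run.cg k hkc).α_next.le
  · obtain ⟨j, -, -, hnext⟩ := (h.run.pg k hkc).next
    rw [hnext]
    split_ifs
    · exact le_rfl
    · nlinarith [c.ζ_mem.2, (h.α_mem k).1]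

/-- From some iteration on, every proximal gradient step is taken with unit step size. -/
lemma eventually_pg_next (h : t.IsRegularRun P c xstar σ a b) :
    ∀ᶠ k in atTop, k ∉ t.Kcg P c → t.x (k + 1) = t.x k + proj (t.I k) (t.s k) ∧
      P.F (t.x (k + 1)) ≤ P.F (t.x k) - c.η * ‖proj (t.I k) (t.s k)‖ ^ 2 := by
  obtain ⟨r, hr, hα⟩ := h.exists_α_ge
  have hζ := c.ζ_mem
  -- The differences of `α` tend to zero, whereas each reduction loses at least `(1 - ζ) r`; so
  -- reductions stop.
  have hlim := tendsto_sub_succ_of_antitone h.α_antitone hα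
  filter_upwards [hlim.eventually (gt_mem_nhds (mul_pos (sub_pos.mpr hζ.2) hr))] with k hk hkc
  obtain ⟨j, hj, hx, hnext⟩ := (h.run.pg k hkc).next
  have hj0 : j = 0 := by
    by_contra hne
    rw [if_neg hne] at hnext
    rw [hnext] at hk
    nlinarith [hα k, hζ.2]
  subst hj0
  have hacc : P.pgAccept c (t.x k) (t.s k) (t.α k) (t.I k) 0 := hj.1
  rw [pow_zero, one_smul] at hx
  rw [Problem.pgAccept, pow_zero, one_smul, ← hx, mul_one] at hacc
  refine ⟨hx, hacc.trans ?_⟩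
  have h1 : 1 ≤ 1 / t.α k := by
    rw [le_div_iff₀ (h.α_mem k).1]; linarith [(h.α_mem k).2]
  have h2 : 0 ≤ c.η * ‖proj (t.I k) (t.s k)‖ ^ 2 := mul_nonneg c.η_mem.1.le (sq_nonneg _)
  nlinarith

lemma norm_s_le_χ (P : Problem n m) (c : Constants) (t : Trace n) (k : ℕ) :
    ‖t.s k‖ ≤ P.χcg c (t.x k) (t.s k) + P.χpg c (t.x k) (t.s k) :=
  norm_le_norm_sub_add_norm_sub_compl _ _

/-- Small proximal steps occur if there are infinitely many proximal gradient iterations. -/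
lemma exists_norm_s_lt_of_frequently_pg (h : t.IsRegularRun P c xstar σ a b)
    (hinf : ∃ᶠ k in atTop, k ∉ t.Kcg P c) {ε : ℝ} (hε : 0 < ε) : ∃ k, ‖t.s k‖ < ε := by
  have hη := c.η_mem.1
  have hφ := c.φ_mem.1
  -- The decrease that a unit proximal step guarantees when `χpg ≥ ε/2`.
  have hd : 0 < c.η * (c.φ * (ε / 2)) ^ 2 := by positivity
  obtain ⟨k, hkc, hstep, hF⟩ := (hinf.and_eventually (h.eventually_pg_next.and
    (h.tendsto_F_sub.eventually (gt_mem_nhds hd)))).exists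
  refine ⟨k, ?_⟩
  obtain ⟨-, hdec⟩ := hstep hkc
  have hlarge := (h.run.pg k hkc).large
  rw [← norm_proj] at hlarge
  have h1 : ‖proj (t.I k) (t.s k)‖ ^ 2 < (c.φ * (ε / 2)) ^ 2 := by
    by_contra! hle
    nlinarith
  have h2 : ‖proj (t.I k) (t.s k)‖ < c.φ * (ε / 2) := lt_of_pow_lt_pow_left₀ 2 (by positivity) h1
  have h3 : P.χpg c (t.x k) (t.s k) < ε / 2 := lt_of_mul_lt_mul_left (hlarge.trans_lt h2) hφ.le
  have h4 : P.χcg c (t.x k) (t.s k) < P.χpg c (t.x k) (t.s k) := not_le.mp hkc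
  linarith [norm_s_le_χ P c t k]

/-- If small proximal steps occur, then the iterates converge to the minimizer. -/
lemma tendsto_of_exists_norm_s_lt (h : t.IsRegularRun P c xstar σ a b)
    (hs : ∀ ε : ℝ, 0 < ε → ∃ k, ‖t.s k‖ < ε) : Tendsto t.x atTop (𝓝 xstar) := by
  obtain ⟨R, hR0, hR⟩ := h.exists_norm_le
  obtain ⟨M, hM0, hM⟩ := h.exists_gradient_le
  obtain ⟨L, hL0, hL⟩ := exists_lipschitz_gradient h.contDiff (R + (M + P.totalWeight))
  obtain ⟨r, hr, hα⟩ := h.exists_α_ge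
  have hσ := h.σ_pos
  have hC : 0 < 1 + 4 / σ * (r⁻¹ + L) := by positivity
  have herr : ∀ k, ‖t.x k - xstar‖ ≤ (1 + 4 / σ * (r⁻¹ + L)) * ‖t.s k‖ := by
    intro k
    have hαk := (h.α_mem k).1
    have h1 := (h.run.pgStep k).dist_le hαk h.differentiable hσ h.convex h.isMin
    have h2 := hL (t.x k) (t.x k + t.s k)
      ((hR k).trans (by linarith [h.norm_s_le hM k, norm_nonneg (t.s k)]))
      ((norm_add_le _ _).trans (add_le_add (hR k) (h.norm_s_le hM k)))
    rw [sub_add_cancel_left, norm_neg] at h2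
    have h3 : ‖(t.α k)⁻¹ • t.s k‖ ≤ r⁻¹ * ‖t.s k‖ := by
      rw [norm_smul, norm_inv, Real.norm_of_nonneg hαk.le]
      gcongr
      exact hα k
    have h4 : σ / 4 * ‖t.x k + t.s k - xstar‖ ≤ (r⁻¹ + L) * ‖t.s k‖ :=
      h1.trans ((norm_add_le _ _).trans (by linarith))
    have h5 : ‖t.x k + t.s k - xstar‖ ≤ 4 / σ * ((r⁻¹ + L) * ‖t.s k‖) := by
      rw [div_mul_eq_mul_div, le_div_iff₀ hσ]; linarith
    have h6 : ‖t.x k - xstar‖ ≤ ‖t.x k + t.s k - xstar‖ + ‖t.s k‖ := by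
      have := _root_.norm_sub_le (t.x k + t.s k - xstar) (t.s k)
      rwa [show t.x k + t.s k - xstar - t.s k = t.x k - xstar by abel] at this
    linarith
  rw [Metric.tendsto_atTop]
  intro ε hε
  have hδ : 0 < σ / 4 * ε ^ 2 := by positivity
  obtain ⟨δ, hδ0, hδF⟩ := Metric.continuous_iff.mp h.continuous_F xstar _ hδ
  obtain ⟨N, hN⟩ := hs (δ / (1 + 4 / σ * (r⁻¹ + L))) (by positivity)
  -- One good index suffices: monotonicity of `F` and the growth bound trap all later iterates near
  -- `xstar`.
  refine ⟨N, fun k hk => ?_⟩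
  have h1 : dist (t.x N) xstar < δ := by
    rw [dist_eq_norm]
    refine (herr N).trans_lt ?_
    rw [lt_div_iff₀ hC] at hN
    linarith
  have h2 := (le_abs_self _).trans_lt (hδF _ h1)
  have h3 : P.F (t.x k) ≤ P.F (t.x N) := h.F_antitone hk
  have h4 := Problem.growth h.convex h.isMin (t.x k)
  rw [dist_eq_norm]
  have h5 : σ / 4 * ‖t.x k - xstar‖ ^ 2 < σ / 4 * ε ^ 2 := by linarith
  exact lt_of_pow_lt_pow_left₀ 2 hε.le (lt_of_mul_lt_mul_left h5 (by positivity))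

end IsRegularRun

end Trace

/-! ### Trial points of the subspace search and global convergence -/

lemma proj_pad (I : Finset (Fin n)) (v : EuclideanSpace ℝ I) : proj I (pad I v) = pad I v := by
  rw [← pad_sub, sub_pad]

lemma pad_apply_of_notMem {I : Finset (Fin n)} (v : EuclideanSpace ℝ I) {j : Fin n} (hj : j ∉ I) :
    pad I v j = 0 := by
  rw [pad_apply, dif_neg hj]

namespace Problem

variable {P : Problem n m} {c : Constants} {x s d : E n} {I : Finset (Fin n)}

lemma cgTrial_apply_of_notMem (v : EuclideanSpace ℝ I) (j : ℕ) {a : Fin n} (ha : a ∉ I) :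
    P.cgTrial c x s (pad I v) I j a = x a := by
  unfold cgTrial
  split_ifs
  · simp [ha]
  · simp [pad_apply_of_notMem v ha]

lemma cgTrial_of_not_τmin_le {j : ℕ} (h : ¬ P.τmin c x s d I ≤ ((c.ξ ^ j : ℝ) : EReal)) :
    P.cgTrial c x s d I j = x + c.ξ ^ j • d := by
  rw [cgTrial, if_neg h]

lemma exists_sub_cgTrial_eq_zero {j : ℕ} (h : P.τmin c x s d I ≤ ((c.ξ ^ j : ℝ) : EReal)) :
    ∃ i, P.G i ⊆ I ∧ sub (P.G i) (P.cgTrial c x s d I j) = 0 := by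
  classical
  have hne : (Finset.univ.filter fun i => P.G i ⊆ I).Nonempty := by
    by_contra hne
    rw [Finset.not_nonempty_iff_eq_empty] at hne
    rw [τmin] at h
    simp only [hne, Finset.inf_empty, top_le_iff] at h
    exact EReal.coe_ne_top _ h
  obtain ⟨i, hi, hτ⟩ := Finset.exists_mem_eq_inf _ hne (P.τgroup c x s d)
  have hiI : P.G i ⊆ I := by simpa using hi
  refine ⟨i, hiI, (sub_eq_zero_iff _ _).mpr fun a ha => ?_⟩
  have hle : P.τgroup c x s d i ≤ ((c.ξ ^ j : ℝ) : EReal) := by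
    rw [← hτ]
    exact h
  rw [cgTrial, if_pos h]
  simp only [hiI ha, if_true]
  rw [if_pos ⟨i, ha, hle⟩]

end Problem

namespace Trace.IsRegularRun

variable {t : Trace n} {P : Problem n m} {c : Constants} {xstar : E n} {σ a b : ℝ}

lemma x_next_apply_of_notMem (h : t.IsRegularRun P c xstar σ a b) {k : ℕ} (hk : k ∈ t.Kcg P c)
    {j : Fin n} (hj : j ∉ P.Icg c (t.x k) (t.s k)) : t.x (k + 1) j = t.x k j := by
  obtain ⟨i, -, hx⟩ := (h.run.cg k hk).x_next
  rw [hx]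
  exact Problem.cgTrial_apply_of_notMem _ _ fun hjI => hj ((h.run.cg k hk).subset hjI)

/-- If finally all iterations are subspace iterations, then finally all of them end with an Armijo
search. -/
lemma eventually_armijo (h : t.IsRegularRun P c xstar σ a b) (hcg : ∀ᶠ k in atTop, k ∈ t.Kcg P c) :
    ∀ᶠ k in atTop, ∀ j : ℕ,
      t.x (k + 1) = P.cgTrial c (t.x k) (t.s k) (pad (t.I k) (t.dbar k)) (t.I k) j →
      ¬ P.τmin c (t.x k) (t.s k) (pad (t.I k) (t.dbar k)) (t.I k) ≤ ((c.ξ ^ j : ℝ) : EReal) := by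
  classical
  obtain ⟨N, hN⟩ := eventually_atTop.mp hcg
  let Z : ℕ → Finset (Fin m) := fun k => Finset.univ.filter fun i => sub (P.G i) (t.x k) = 0
  -- Zero groups lie outside `Icg`, hence subspace steps leave them zero.
  have hmono : Monotone fun k => Z (N + k) := by
    refine monotone_nat_of_le_succ fun k i hi => ?_
    simp only [Z, Finset.mem_filter, Finset.mem_univ, true_and] at hi ⊢
    rw [← hi]
    refine sub_congr fun j hj => h.x_next_apply_of_notMem (hN _ (Nat.le_add_right N k)) fun hjI => ?_
    exact ((Problem.mem_Icg hj).mp hjI).1.1 hi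
  obtain ⟨K, hK⟩ := WellFoundedGT.monotone_chain_condition (⟨fun k => Z (N + k), hmono⟩ : ℕ →o _)
  filter_upwards [eventually_ge_atTop (N + K)] with k hk j hx hτ
  obtain ⟨i, hiI, hi⟩ := Problem.exists_sub_cgTrial_eq_zero hτ
  rw [← hx] at hi
  obtain ⟨l, rfl⟩ := Nat.exists_eq_add_of_le ((Nat.le_add_right N K).trans hk)
  -- After stabilization a group zeroed by this step was zero before it, which is impossible for a
  -- group in `Icg`.
  have h1 : Z (N + K) = Z (N + l) := hK l (by omega)
  have h2 : Z (N + K) = Z (N + (l + 1)) := hK (l + 1) (by omega)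
  have h3 : i ∈ Z (N + (l + 1)) := by simpa [Z, ← add_assoc] using hi
  rw [← h2, h1] at h3
  have h4 : sub (P.G i) (t.x (N + l)) = 0 := by simpa [Z] using h3
  exact Problem.sub_ne_zero_of_subset_Icg
    (hiI.trans (h.run.cg _ (hN _ (Nat.le_add_right N l))).subset) h4

lemma exists_norm_gradSub_le (h : t.IsRegularRun P c xstar σ a b) :
    ∃ M : ℝ, 0 < M ∧ ∀ k, ‖gradSub (P.Icg c (t.x k) (t.s k)) P.F (t.x k)‖ ≤ M := by
  obtain ⟨M, hM0, hM⟩ := h.exists_gradient_le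
  have hw := P.totalWeight_nonneg
  refine ⟨M + P.totalWeight + 1, by positivity, fun k => ?_⟩
  have h1 := Problem.norm_gradSub_le (h.differentiable (t.x k))
    (Problem.isGroupUnion_Icg (c := c) (s := t.s k))
    (fun i hi => Problem.sub_ne_zero_of_subset_Icg hi)
  linarith [hM k]

/-- A positive lower bound on the reduced gradient bounds the decrease of an Armijo step away from
zero. -/
lemma exists_le_F_sub_of_armijo (h : t.IsRegularRun P c xstar σ a b) {ε : ℝ} (hε : 0 < ε) :
    ∃ δ : ℝ, 0 < δ ∧ ∀ k ∈ t.Kcg P c, t.I k = P.Icg c (t.x k) (t.s k) →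
      (∀ j : ℕ, t.x (k + 1) = P.cgTrial c (t.x k) (t.s k) (pad (t.I k) (t.dbar k)) (t.I k) j →
        ¬ P.τmin c (t.x k) (t.s k) (pad (t.I k) (t.dbar k)) (t.I k) ≤ ((c.ξ ^ j : ℝ) : EReal)) →
      ε ≤ ‖gradSub (t.I k) P.F (t.x k)‖ → δ ≤ P.F (t.x k) - P.F (t.x (k + 1)) := by
  obtain ⟨R, hR0, hR⟩ := h.exists_norm_le
  obtain ⟨M, hM0, hM⟩ := h.exists_norm_gradSub_le
  have ha := h.a_pos
  have hb := h.b_pos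
  have hη := c.η_mem
  have hξ := c.ξ_mem
  have hw := P.totalWeight_nonneg
  have hκ := c.κ₂_pos
  set D := 2 * M / a with hD
  have hD0 : 0 < D := by positivity
  obtain ⟨L, hL0, hL⟩ := exists_lipschitz_gradient h.contDiff (R + D)
  set ρ := c.κ₂ * ε ^ c.p with hρ
  have hρ0 : 0 < ρ := mul_pos hκ (Real.rpow_pos_of_pos hε _)
  have hsin := Problem.sin_θ_mem c
  set C := L + P.totalWeight / (2 * ρ) with hC
  have hC0 : 0 < C := by positivity
  -- The three bounds: 1 covers `j = 0`, the second keeps `T ≤ τ`, the third makes the quadratic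
  -- error `C D² T` at most `(1 - η) ε²/b`.
  set T := min 1 (min ((1 - Real.sin c.θ) * ρ / (2 * D)) ((1 - c.η) * (ε ^ 2 / b) / (C * D ^ 2)))
    with hT
  have hsin1 : 0 < 1 - Real.sin c.θ := sub_pos.mpr hsin.2
  have hη1 : 0 < 1 - c.η := sub_pos.mpr hη.2
  have hT0 : 0 < T := lt_min one_pos (lt_min (by positivity) (by positivity))
  refine ⟨c.η * (c.ξ * T) * (ε ^ 2 / b),
    mul_pos (mul_pos hη.1 (mul_pos hξ.1 hT0)) (by positivity), fun k hk hI harm hg => ?_⟩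
  obtain ⟨j, hfail, hx, ⟨hτ, -⟩ | ⟨hτ, hF⟩⟩ := h.cg_cases hk
  · exact absurd hτ (harm j hx)
  have hdir := (h.run.cg k hk).direction
  have hgM : ‖gradSub (t.I k) P.F (t.x k)‖ ≤ M := by
    have := hM k
    rwa [← hI] at this
  have hdD : ‖t.dbar k‖ ≤ D := by
    refine (hdir.norm_le ha fun v => (h.H_bound k hk v).1).trans ?_
    rw [hD]
    gcongr
  have hgd : inner ℝ (gradSub (t.I k) P.F (t.x k)) (t.dbar k) ≤ -(ε ^ 2 / b) := by
    refine (h.inner_dbar_le hk).trans (neg_le_neg ?_)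
    gcongr
  -- This needs the full set `I = Icg`: the threshold for the groups involves the gradient over
  -- `Icg`, which is then at least `ε`.
  have hgroups : ∀ i, P.G i ⊆ t.I k → ρ ≤ ‖sub (P.G i) (t.x k)‖ := by
    intro i hi
    rw [hI] at hi
    refine le_trans ?_ (Problem.gradSub_rpow_le_of_subset_Icg hi)
    rw [← hI, hρ]
    have := c.p_pos
    gcongr
  have hstep : c.ξ * T ≤ c.ξ ^ j := by
    rcases Nat.eq_zero_or_pos j with rfl | hj
    · rw [pow_zero]
      exact mul_le_one₀ hξ.2.le hT0.le (min_le_left _ _)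
    · obtain ⟨l, rfl⟩ := Nat.exists_eq_succ_of_ne_zero hj.ne'
      rw [pow_succ', mul_le_mul_iff_right₀ hξ.1]
      by_contra! hlt
      -- If `ξ^j` were below `ξ T`, the preceding trial size `ξ^l < T` would already have been
      -- accepted.
      refine hfail l (Nat.lt_succ_self l) ?_
      have hξl : 0 < c.ξ ^ l := pow_pos hξ.1 l
      have hτT : (T : EReal)
          ≤ P.τmin c (t.x k) (t.s k) (pad (t.I k) (t.dbar k)) (t.I k) := by
        refine Problem.le_τmin_of_norm_le hT0 fun i hi => ?_
        rw [norm_pad]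
        have h1 : T ≤ (1 - Real.sin c.θ) * ρ / (2 * D) :=
          (min_le_right _ _).trans (min_le_left _ _)
        rw [le_div_iff₀ (by positivity)] at h1
        have h2 : 0 < (1 - Real.sin c.θ) * ρ := by positivity
        refine lt_of_lt_of_le ?_ (mul_le_mul_of_nonneg_left (hgroups i hi) hsin1.le)
        nlinarith
      have hτl : ¬ P.τmin c (t.x k) (t.s k) (pad (t.I k) (t.dbar k)) (t.I k)
          ≤ ((c.ξ ^ l : ℝ) : EReal) := by
        rw [not_le]
        exact lt_of_lt_of_le (EReal.coe_lt_coe_iff.mpr hlt) hτT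
      rw [Problem.cgAccept, if_neg hτl, Problem.cgTrial_of_not_τmin_le hτl, sub_pad]
      have hl1 : c.ξ ^ l ≤ 1 := pow_le_one₀ hξ.1.le hξ.2.le
      have hnorm : ‖c.ξ ^ l • pad (t.I k) (t.dbar k)‖ ≤ D := by
        rw [norm_smul, Real.norm_of_nonneg hξl.le, norm_pad]
        nlinarith [norm_nonneg (t.dbar k)]
      have h1 := descent h.differentiable hL hL0 (x := t.x k)
        (d := c.ξ ^ l • pad (t.I k) (t.dbar k)) ((hR k).trans (by linarith))
        ((norm_add_le _ _).trans (add_le_add (hR k) hnorm))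
      have h2 := Problem.r_add_proj_le (h.differentiable (t.x k)) (h.run.cg k hk).union hρ0 hgroups
        (c.ξ ^ l • pad (t.I k) (t.dbar k))
      rw [← pad_smul, proj_pad, sub_pad, inner_smul_right, norm_smul, Real.norm_of_nonneg hξl.le]
        at h2
      rw [← pad_smul, norm_pad, norm_smul, Real.norm_of_nonneg hξl.le] at h1
      rw [← pad_smul]
      have h3 : c.ξ ^ l ≤ (1 - c.η) * (ε ^ 2 / b) / (C * D ^ 2) :=
        hlt.le.trans ((min_le_right _ _).trans (min_le_right _ _))
      rw [le_div_iff₀ (by positivity)] at h3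
      have h4 : C * (c.ξ ^ l * ‖t.dbar k‖) ^ 2 ≤ c.ξ ^ l * ((1 - c.η) * (ε ^ 2 / b)) := by
        calc C * (c.ξ ^ l * ‖t.dbar k‖) ^ 2 ≤ C * (c.ξ ^ l * D) ^ 2 := by gcongr
          _ = c.ξ ^ l * (c.ξ ^ l * (C * D ^ 2)) := by ring
          _ ≤ _ := by gcongr
      have h5 : (1 - c.η) * c.ξ ^ l * inner ℝ (gradSub (t.I k) P.F (t.x k)) (t.dbar k)
          ≤ (1 - c.η) * c.ξ ^ l * -(ε ^ 2 / b) := by gcongr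
      simp only [Problem.F] at *
      rw [hC] at h4
      nlinarith
  have h6 : c.η * c.ξ ^ j * inner ℝ (gradSub (t.I k) P.F (t.x k)) (t.dbar k)
      ≤ c.η * c.ξ ^ j * -(ε ^ 2 / b) :=
    mul_le_mul_of_nonneg_left hgd (mul_nonneg hη.1.le (pow_nonneg hξ.1.le j))
  have h7 : c.η * (c.ξ * T) * (ε ^ 2 / b) ≤ c.η * c.ξ ^ j * (ε ^ 2 / b) := by
    have := hη.1
    gcongr
  linarith

/-- The decreases of `F` tend to zero, so the reduced gradient becomes small; it dominates `χcg`,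
which dominates `χpg` in subspace iterations. -/
lemma exists_norm_s_lt_of_eventually_cg (h : t.IsRegularRun P c xstar σ a b)
    (hcg : ∀ᶠ k in atTop, k ∈ t.Kcg P c)
    (hI : ∀ᶠ k in atTop, k ∈ t.Kcg P c → t.I k = P.Icg c (t.x k) (t.s k)) {ε : ℝ} (hε : 0 < ε) :
    ∃ k, ‖t.s k‖ < ε := by
  obtain ⟨δ, hδ, hdec⟩ := h.exists_le_F_sub_of_armijo (half_pos hε)
  obtain ⟨k, hk, hIk, harm, hF⟩ := (hcg.and (hI.and ((h.eventually_armijo hcg).and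
    (h.tendsto_F_sub.eventually (gt_mem_nhds hδ))))).exists
  refine ⟨k, ?_⟩
  have hg : ‖gradSub (t.I k) P.F (t.x k)‖ < ε / 2 := by
    by_contra! hle
    exact absurd (hdec k hk (hIk hk) harm hle) (not_le.mpr hF)
  rw [hIk hk] at hg
  have hα := h.α_mem k
  have h1 := (h.run.pgStep k).norm_sub_le_gradSub hα.1 (h.differentiable (t.x k))
    (Problem.isGroupUnion_Icg (c := c) (s := t.s k))
    (fun i hi => Problem.sub_ne_zero_of_subset_Icg hi)
  have h2 : P.χcg c (t.x k) (t.s k) ≤ ‖gradSub (P.Icg c (t.x k) (t.s k)) P.F (t.x k)‖ := by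
    refine h1.trans ?_
    nlinarith [norm_nonneg (gradSub (P.Icg c (t.x k) (t.s k)) P.F (t.x k)), hα.2]
  have h3 : P.χpg c (t.x k) (t.s k) ≤ P.χcg c (t.x k) (t.s k) := hk
  linarith [norm_s_le_χ P c t k]

/-- Global convergence. -/
theorem tendsto_x (h : t.IsRegularRun P c xstar σ a b)
    (hI : ∀ᶠ k in atTop, k ∈ t.Kcg P c → t.I k = P.Icg c (t.x k) (t.s k)) :
    Tendsto t.x atTop (𝓝 xstar) := by
  refine h.tendsto_of_exists_norm_s_lt fun ε hε => ?_
  by_cases hcg : ∀ᶠ k in atTop, k ∈ t.Kcg P c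
  · exact h.exists_norm_s_lt_of_eventually_cg hcg hI hε
  · exact h.exists_norm_s_lt_of_frequently_pg (not_eventually.mp hcg) hε

end Trace.IsRegularRun

/-! ### Identification of the support of the minimizer -/

open Classical in
/-- The union of the groups that do not vanish at `x`. -/
noncomputable def Problem.support (P : Problem n m) (x : E n) : Finset (Fin n) :=
  Finset.univ.filter fun j => ∃ i, j ∈ P.G i ∧ sub (P.G i) x ≠ 0

namespace Problem

variable {P : Problem n m} {xstar : E n}

lemma mem_support {i : Fin m} {j : Fin n} (hj : j ∈ P.G i) (x : E n) :
    j ∈ P.support x ↔ sub (P.G i) x ≠ 0 := by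
  simp only [support, Finset.mem_filter, Finset.mem_univ, true_and]
  constructor
  · rintro ⟨i', hj', h⟩
    rwa [P.group_unique hj hj']
  · exact fun h => ⟨i, hj, h⟩

lemma apply_eq_zero_of_notMem_support {x : E n} {j : Fin n} (hj : j ∉ P.support x) : x j = 0 := by
  obtain ⟨i, hi⟩ := P.group_cover j
  have h : sub (P.G i) x = 0 := by
    by_contra h
    exact hj ((mem_support hi x).mpr h)
  exact (sub_eq_zero_iff _ _).mp h j hi

/-- This holds off the support as well, where a derivative that does not exist has the value 0 by
convention. -/
lemma partialD_F_eq_zero (hstar : IsMinOn P.F Set.univ xstar) (j : Fin n) :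
    partialD P.F j xstar = 0 := by
  refine IsLocalMin.deriv_eq_zero (Eventually.of_forall fun t => ?_)
  simpa using hstar (Set.mem_univ (xstar + t • EuclideanSpace.single j (1 : ℝ)))

lemma tendsto_partialD_F (hf : ContDiff ℝ 2 P.f) (hstar : IsMinOn P.F Set.univ xstar) {j : Fin n}
    (hj : j ∈ P.support xstar) : Tendsto (partialD P.F j) (𝓝 xstar) (𝓝 0) := by
  obtain ⟨i, hi⟩ := P.group_cover j
  have h0 : sub (P.G i) xstar ≠ 0 := (mem_support hi xstar).mp hj
  have hdf : Differentiable ℝ P.f := hf.differentiable (by norm_num)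
  have hsub := continuous_sub (P.G i)
  have hev : ∀ᶠ x in 𝓝 xstar, sub (P.G i) x ≠ 0 := hsub.continuousAt.eventually_ne h0
  have hcg := (contDiff_gradient hf).continuous
  have hcont : ContinuousAt
      (fun x : E n => gradient P.f x j + P.weight i * (x j / ‖sub (P.G i) x‖)) xstar := by
    have hne : ‖sub (P.G i) xstar‖ ≠ 0 := norm_ne_zero_iff.mpr h0
    refine ContinuousAt.add (by fun_prop) (ContinuousAt.mul (by fun_prop) ?_)
    exact ContinuousAt.div (by fun_prop) (by fun_prop) hne
  have heq : (fun x : E n => gradient P.f x j + P.weight i * (x j / ‖sub (P.G i) x‖))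
      =ᶠ[𝓝 xstar] partialD P.F j := by
    filter_upwards [hev] with x hx
    exact (partialD_F (hdf x) hi hx).symm
  have h1 : gradient P.f xstar j + P.weight i * (xstar j / ‖sub (P.G i) xstar‖) = 0 := by
    rw [← partialD_F (hdf xstar) hi h0, partialD_F_eq_zero hstar]
  have h2 := hcont.tendsto
  rw [h1] at h2
  exact h2.congr' heq

lemma tendsto_norm_gradSub_F (hf : ContDiff ℝ 2 P.f) (hstar : IsMinOn P.F Set.univ xstar)
    {I : Finset (Fin n)} (hI : I ⊆ P.support xstar) :
    Tendsto (fun x => ‖gradSub I P.F x‖) (𝓝 xstar) (𝓝 0) := by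
  have h1 : Tendsto (fun x => ∑ j ∈ I, partialD P.F j x ^ 2) (𝓝 xstar) (𝓝 (∑ j ∈ I, 0 ^ 2)) :=
    tendsto_finsetSum _ fun j hj => (tendsto_partialD_F hf hstar (hI hj)).pow 2
  have h2 := h1.sqrt
  simp only [ne_eq, OfNat.ofNat_ne_zero, not_false_eq_true, zero_pow, Finset.sum_const_zero,
    Real.sqrt_zero] at h2
  refine h2.congr fun x => ?_
  rw [gradSub_eq_sub, Real.sqrt_eq_iff_mul_self_eq (Finset.sum_nonneg fun j _ => sq_nonneg _)
    (norm_nonneg _), ← sq, norm_sub_sq]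

end Problem

namespace Trace.IsRegularRun

variable {t : Trace n} {P : Problem n m} {c : Constants} {xstar : E n} {σ a b : ℝ}

lemma tendsto_s (h : t.IsRegularRun P c xstar σ a b) (hx : Tendsto t.x atTop (𝓝 xstar)) :
    Tendsto t.s atTop (𝓝 0) := by
  have he : Tendsto (fun k => ‖t.x k - xstar‖) atTop (𝓝 0) :=
    tendsto_iff_norm_sub_tendsto_zero.mp hx
  have hg : Tendsto (fun k => ‖gradient P.f (t.x k) - gradient P.f xstar‖) atTop (𝓝 0) :=
    tendsto_iff_norm_sub_tendsto_zero.mp ((h.continuous_gradient.tendsto xstar).comp hx)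
  have hlim := (he.add hg).const_mul 2
  rw [add_zero, mul_zero] at hlim
  refine squeeze_zero_norm (fun k => ?_) hlim
  have hα := h.α_mem k
  have h1 := (h.run.pgStep k).norm_sq_le hα.1 h.differentiable h.isMin
  set u := ‖t.s k‖ with hu
  set e := ‖t.x k - xstar‖ with he'
  set g := ‖gradient P.f (t.x k) - gradient P.f xstar‖ with hg'
  have hu0 : 0 ≤ u := norm_nonneg _
  have he0 : 0 ≤ e := norm_nonneg _
  have hg0 : 0 ≤ g := norm_nonneg _
  have h2 : t.α k * g * (u + e) ≤ g * (u + e) := by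
    rw [mul_assoc]
    exact mul_le_of_le_one_left (by positivity) hα.2
  -- With `u² ≤ u e + g (u + e)`, the inequality `u > 2 (e + g)` is impossible.
  by_contra! hlt
  nlinarith

/-- The active groups are zero after a proximal step. -/
lemma eventually_sub_add_eq_zero (h : t.IsRegularRun P c xstar σ a b)
    (hx : Tendsto t.x atTop (𝓝 xstar))
    (hnondeg : ∀ i, sub (P.G i) xstar = 0 → ‖sub (P.G i) (gradient P.f xstar)‖ < P.weight i) :
    ∀ᶠ k in atTop, ∀ i, sub (P.G i) xstar = 0 → sub (P.G i) (t.x k + t.s k) = 0 := by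
  obtain ⟨r, hr, hα⟩ := h.exists_α_ge
  rw [eventually_all]
  intro i
  by_cases hi : sub (P.G i) xstar = 0
  swap
  · exact Eventually.of_forall fun k h0 => absurd h0 hi
  have hsub := continuous_sub (P.G i)
  have hcg := h.continuous_gradient
  have hcont : Continuous fun x : E n =>
      r⁻¹ * ‖sub (P.G i) x‖ + ‖sub (P.G i) (gradient P.f x)‖ := by fun_prop
  have hlt : r⁻¹ * ‖sub (P.G i) xstar‖ + ‖sub (P.G i) (gradient P.f xstar)‖ < P.weight i := by
    simpa [hi] using hnondeg i hi
  filter_upwards [((hcont.tendsto xstar).comp hx).eventually (gt_mem_nhds hlt)] with k hk _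
  refine (h.run.pgStep k).sub_add_eq_zero (h.α_mem k).1 (lt_of_le_of_lt ?_ hk)
  simp only [Function.comp_apply]
  gcongr
  exact hα k

/-- The support of the minimizer is finally identified. -/
lemma eventually_Icg_eq (h : t.IsRegularRun P c xstar σ a b) (hx : Tendsto t.x atTop (𝓝 xstar))
    (hnondeg : ∀ i, sub (P.G i) xstar = 0 → ‖sub (P.G i) (gradient P.f xstar)‖ < P.weight i) :
    ∀ᶠ k in atTop, P.Icg c (t.x k) (t.s k) = P.support xstar := by
  have hκ₁ := c.κ₁_pos
  have hκ₂ := c.κ₂_pos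
  have hp := c.p_pos
  have hxs : Tendsto (fun k => t.x k + t.s k) atTop (𝓝 xstar) := by
    simpa using hx.add (h.tendsto_s hx)
  have hpos : ∀ᶠ k in atTop, ∀ i, sub (P.G i) xstar ≠ 0 →
      (sub (P.G i) (t.x k) ≠ 0 ∧ sub (P.G i) (t.x k + t.s k) ≠ 0 ∧
        c.κ₁ * ‖gradSub (P.G i) P.F (t.x k)‖ ≤ ‖sub (P.G i) (t.x k)‖) ∧
        c.κ₂ * ‖gradSub (P.support xstar) P.F (t.x k)‖ ^ c.p ≤ ‖sub (P.G i) (t.x k)‖ := by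
    rw [eventually_all]
    intro i
    by_cases hi : sub (P.G i) xstar = 0
    · exact Eventually.of_forall fun k h0 => absurd hi h0
    have hsub := continuous_sub (P.G i)
    have hGS : P.G i ⊆ P.support xstar := fun j hj => (Problem.mem_support hj xstar).mpr hi
    have hn : Tendsto (fun k => ‖sub (P.G i) (t.x k)‖) atTop (𝓝 ‖sub (P.G i) xstar‖) :=
      ((hsub.tendsto xstar).comp hx).norm
    have hn0 : 0 < ‖sub (P.G i) xstar‖ := norm_pos_iff.mpr hi
    have hg1 : Tendsto (fun k => c.κ₁ * ‖gradSub (P.G i) P.F (t.x k)‖) atTop (𝓝 0) := by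
      simpa using ((Problem.tendsto_norm_gradSub_F h.contDiff h.isMin hGS).comp hx).const_mul c.κ₁
    have hg2 : Tendsto (fun k => c.κ₂ * ‖gradSub (P.support xstar) P.F (t.x k)‖ ^ c.p) atTop
        (𝓝 0) := by
      have := (((Problem.tendsto_norm_gradSub_F h.contDiff h.isMin
        (subset_refl (P.support xstar))).comp hx).rpow_const (Or.inr hp.le)).const_mul c.κ₂
      simpa [Real.zero_rpow hp.ne'] using this
    filter_upwards [((hsub.tendsto xstar).comp hx).eventually_ne hi,
      ((hsub.tendsto xstar).comp hxs).eventually_ne hi, hg1.eventually_lt hn hn0,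
      hg2.eventually_lt hn hn0] with k h1 h2 h3 h4 _
    exact ⟨⟨h1, h2, h3.le⟩, h4.le⟩
  filter_upwards [hpos, h.eventually_sub_add_eq_zero hx hnondeg] with k hk hk0
  -- `IcgBar` has to be identified before `Icg`, since its gradient enters the threshold of
  -- `Ismall`.
  have hbar : P.IcgBar c (t.x k) (t.s k) = P.support xstar := by
    ext j
    obtain ⟨i, hi⟩ := P.group_cover j
    rw [Problem.mem_IcgBar hi, Problem.mem_support hi]
    exact ⟨fun h1 h0 => h1.2.1 (hk0 i h0), fun h1 => (hk i h1).1⟩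
  ext j
  obtain ⟨i, hi⟩ := P.group_cover j
  rw [Problem.mem_Icg hi, Problem.mem_support hi, hbar]
  exact ⟨fun h1 h0 => h1.1.2.1 (hk0 i h0), fun h1 => hk i h1⟩

/-- Finally all iterations are subspace iterations in the support of the minimizer. -/
lemma eventually_mem_Kcg (h : t.IsRegularRun P c xstar σ a b) (hx : Tendsto t.x atTop (𝓝 xstar))
    (hnondeg : ∀ i, sub (P.G i) xstar = 0 → ‖sub (P.G i) (gradient P.f xstar)‖ < P.weight i)
    (hI : ∀ᶠ k in atTop, (k ∈ t.Kcg P c → t.I k = P.Icg c (t.x k) (t.s k)) ∧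
      (k ∉ t.Kcg P c → t.I k = P.Ipg c (t.x k) (t.s k))) :
    ∀ᶠ k in atTop, k ∈ t.Kcg P c ∧ t.I k = P.support xstar ∧
      ∀ j ∉ P.support xstar, t.x k j = 0 := by
  obtain ⟨N, hN⟩ := eventually_atTop.mp ((h.eventually_Icg_eq hx hnondeg).and
    ((h.eventually_sub_add_eq_zero hx hnondeg).and (h.eventually_pg_next.and hI)))
  have hcoord : ∀ k ≥ N, ∀ j ∉ P.support xstar, (t.x k + t.s k) j = 0 := by
    intro k hk j hj
    obtain ⟨i, hi⟩ := P.group_cover j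
    have h0 : sub (P.G i) xstar = 0 := by
      by_contra h0
      exact hj ((Problem.mem_support hi xstar).mpr h0)
    exact (sub_eq_zero_iff _ _).mp ((hN k hk).2.1 i h0) j hi
  have hcg : ∀ k ≥ N, k ∈ t.Kcg P c → ∀ j ∉ P.support xstar, t.x (k + 1) j = t.x k j := by
    intro k hk hkc j hj
    refine h.x_next_apply_of_notMem hkc ?_
    rwa [(hN k hk).1]
  -- A unit step on the complement of the support replaces `x` there by `x + s`, which is zero.
  have hpg : ∀ k ≥ N, k ∉ t.Kcg P c → ∀ j ∉ P.support xstar, t.x (k + 1) j = 0 := by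
    intro k hk hkc j hj
    rw [((hN k hk).2.2.1 hkc).1, (hN k hk).2.2.2.2 hkc, Problem.Ipg, (hN k hk).1]
    simpa [hj] using hcoord k hk j hj
  -- Either a proximal iteration clears the coordinates off the support, or they are frozen from `N`
  -- on and equal their limit 0.
  obtain ⟨k₀, hk₀, hz₀⟩ : ∃ k₀ ≥ N, ∀ j ∉ P.support xstar, t.x k₀ j = 0 := by
    by_cases hex : ∃ k ≥ N, k ∉ t.Kcg P c
    · obtain ⟨k, hk, hkc⟩ := hex
      exact ⟨k + 1, by omega, hpg k hk hkc⟩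
    · push Not at hex
      refine ⟨N, le_rfl, fun j hj => ?_⟩
      have hconst : ∀ k ≥ N, t.x k j = t.x N j := by
        intro k hk
        induction k, hk using Nat.le_induction with
        | base => rfl
        | succ k hk ih => rw [hcg k hk (hex k hk) j hj, ih]
      have hlim : Tendsto (fun k => t.x k j) atTop (𝓝 (xstar j)) := by
        have hc : Continuous fun x : E n => x j := by fun_prop
        exact (hc.tendsto xstar).comp hx
      have hlim' : Tendsto (fun k => t.x k j) atTop (𝓝 (t.x N j)) :=
        tendsto_const_nhds.congr' (by
          filter_upwards [eventually_ge_atTop N] with k hk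
          exact (hconst k hk).symm)
      rw [tendsto_nhds_unique hlim' hlim, Problem.apply_eq_zero_of_notMem_support hj]
  have hz : ∀ k ≥ k₀, ∀ j ∉ P.support xstar, t.x k j = 0 := by
    intro k hk
    induction k, hk using Nat.le_induction with
    | base => exact hz₀
    | succ k hk ih =>
      intro j hj
      by_cases hkc : k ∈ t.Kcg P c
      · rw [hcg k (hk₀.trans hk) hkc j hj, ih j hj]
      · exact hpg k (hk₀.trans hk) hkc j hj
  filter_upwards [eventually_ge_atTop k₀] with k hk
  have hkN := hN k (hk₀.le.trans hk)
  have hkc : k ∈ t.Kcg P c := by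
    have h0 : P.χpg c (t.x k) (t.s k) = 0 := by
      rw [Problem.χpg, Problem.Ipg, hkN.1, norm_eq_zero, sub_eq_zero_iff]
      intro j hj
      have hj' : j ∉ P.support xstar := (Finset.mem_sdiff.mp hj).2
      have h1 := hcoord k (hk₀.le.trans hk) j hj'
      rw [PiLp.add_apply, hz k hk j hj', zero_add] at h1
      exact h1
    change P.χpg c (t.x k) (t.s k) ≤ P.χcg c (t.x k) (t.s k)
    rw [h0]
    exact norm_nonneg _
  exact ⟨hkc, (hkN.2.2.2.1 hkc).trans hkN.1, hz k hk⟩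

end Trace.IsRegularRun

/-! ### Inexact Newton steps -/

section Newton

variable {V : Type*} [NormedAddCommGroup V] [NormedSpace ℝ V] {ψ : V → ℝ} {z : V}

/-- Second-order Taylor estimates near a point where the Hessian is Lipschitz. -/
lemma exists_taylor_bounds (hψ : ContDiffAt ℝ 2 ψ z)
    (hLip : ∃ K : NNReal, ∃ U ∈ 𝓝 z, LipschitzOnWith K (fderiv ℝ (fderiv ℝ ψ)) U) :
    ∃ K M δ : ℝ, 0 ≤ K ∧ 0 ≤ M ∧ 0 < δ ∧ ∀ v ∈ Metric.ball z δ,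
      ‖fderiv ℝ (fderiv ℝ ψ) v‖ ≤ M ∧ ∀ w ∈ Metric.ball z δ,
      ‖fderiv ℝ ψ w - fderiv ℝ ψ v‖ ≤ M * ‖w - v‖ ∧
      ‖fderiv ℝ ψ w - fderiv ℝ ψ v - fderiv ℝ (fderiv ℝ ψ) v (w - v)‖ ≤ K * ‖w - v‖ ^ 2 ∧
      |ψ w - ψ v - fderiv ℝ ψ v (w - v) - 1 / 2 * fderiv ℝ (fderiv ℝ ψ) v (w - v) (w - v)|
        ≤ K * ‖w - v‖ ^ 3 := by
  obtain ⟨K, U, hU, hK⟩ := hLip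
  have hev : ∀ᶠ v in 𝓝 z, ContDiffAt ℝ 2 ψ v := hψ.eventually (by simp)
  obtain ⟨δ, hδ, hball⟩ := Metric.eventually_nhds_iff_ball.mp (hev.and hU)
  have hdiff : ∀ v ∈ Metric.ball z δ, HasFDerivAt ψ (fderiv ℝ ψ v) v := fun v hv =>
    ((hball v hv).1.differentiableAt (by norm_num)).hasFDerivAt
  have hdiff2 : ∀ v ∈ Metric.ball z δ,
      HasFDerivAt (fderiv ℝ ψ) (fderiv ℝ (fderiv ℝ ψ) v) v := fun v hv =>
    (((hball v hv).1.fderiv_right (m := 1) (by norm_num)).differentiableAt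
      (by norm_num)).hasFDerivAt
  have hz : z ∈ Metric.ball z δ := Metric.mem_ball_self hδ
  have hA : ∀ v ∈ Metric.ball z δ,
      ‖fderiv ℝ (fderiv ℝ ψ) v‖ ≤ ‖fderiv ℝ (fderiv ℝ ψ) z‖ + K * δ := by
    intro v hv
    have h1 := hK.dist_le_mul v (hball v hv).2 z (hball z hz).2
    rw [dist_eq_norm] at h1
    have h2 := norm_le_norm_add_norm_sub' (fderiv ℝ (fderiv ℝ ψ) v) (fderiv ℝ (fderiv ℝ ψ) z)
    have h3 : K * dist v z ≤ K * δ := by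
      have := (Metric.mem_ball.mp hv).le
      gcongr
    linarith
  have hgrad : ∀ v ∈ Metric.ball z δ, ∀ w ∈ Metric.ball z δ,
      ‖fderiv ℝ ψ w - fderiv ℝ ψ v - fderiv ℝ (fderiv ℝ ψ) v (w - v)‖ ≤ K * ‖w - v‖ ^ 2 := by
    intro v hv w hw
    have hseg : segment ℝ v w ⊆ Metric.ball z δ := (convex_ball z δ).segment_subset hv hw
    have := (convex_segment v w).norm_image_sub_le_of_norm_hasFDerivWithin_le'
      (f := fderiv ℝ ψ) (f' := fderiv ℝ (fderiv ℝ ψ)) (φ := fderiv ℝ (fderiv ℝ ψ) v)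
      (C := K * ‖w - v‖) (fun y hy => (hdiff2 y (hseg hy)).hasFDerivWithinAt) (fun y hy => ?_)
      (left_mem_segment ℝ v w) (right_mem_segment ℝ v w)
    · refine this.trans (le_of_eq (by ring))
    · have h1 := hK.dist_le_mul y (hball y (hseg hy)).2 v (hball v hv).2
      rw [dist_eq_norm, dist_eq_norm] at h1
      have h2 := norm_sub_le_of_mem_segment hy
      exact h1.trans (by gcongr)
  refine ⟨K, ‖fderiv ℝ (fderiv ℝ ψ) z‖ + K * δ, δ, K.2, by positivity, hδ,
    fun v hv => ⟨hA v hv, fun w hw => ⟨?_, hgrad v hv w hw, ?_⟩⟩⟩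
  · exact (convex_ball z δ).norm_image_sub_le_of_norm_hasFDerivWithin_le
      (fun y hy => (hdiff2 y hy).hasFDerivWithinAt) hA hv hw
  · have hseg : segment ℝ v w ⊆ Metric.ball z δ := (convex_ball z δ).segment_subset hv hw
    set A := fderiv ℝ (fderiv ℝ ψ) v with hAdef
    have hsymm : ∀ u u', A u u' = A u' u := fun u u' =>
      ((hball v hv).1.isSymmSndFDerivAt (by simp)).eq u u'
    -- Symmetry of `A` gives the derivative of the quadratic term; the mean value inequality then
    -- turns the gradient estimate into the cubic one.
    have hder : ∀ y ∈ Metric.ball z δ, HasFDerivAt (fun y => ψ y - 1 / 2 * A (y - v) (y - v))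
        (fderiv ℝ ψ y - A (y - v)) y := by
      intro y hy
      have h1 : HasFDerivAt (fun y => y - v) (ContinuousLinearMap.id ℝ V) y :=
        (hasFDerivAt_id y).sub_const v
      have h2 : HasFDerivAt (fun y => A (y - v)) (A.comp (ContinuousLinearMap.id ℝ V)) y :=
        A.hasFDerivAt.comp y h1
      have h3 := (hdiff y hy).sub ((h2.clm_apply h1).const_mul (1 / 2))
      refine h3.congr_fderiv (ContinuousLinearMap.ext fun u => ?_)
      have h4 := hsymm u (y - v)
      simp only [ContinuousLinearMap.comp_id, map_sub, FunLike.coe_sub, Pi.sub_apply] at h4 ⊢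
      simp [h4]
      ring
    have := (convex_segment v w).norm_image_sub_le_of_norm_hasFDerivWithin_le'
      (f := fun y => ψ y - 1 / 2 * A (y - v) (y - v)) (f' := fun y => fderiv ℝ ψ y - A (y - v))
      (φ := fderiv ℝ ψ v) (C := K * ‖w - v‖ ^ 2)
      (fun y hy => (hder y (hseg hy)).hasFDerivWithinAt) (fun y hy => ?_)
      (left_mem_segment ℝ v w) (right_mem_segment ℝ v w)
    · rw [Real.norm_eq_abs] at this
      have e : ψ w - 1 / 2 * A (w - v) (w - v) - (ψ v - 1 / 2 * A (v - v) (v - v))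
          - fderiv ℝ ψ v (w - v)
          = ψ w - ψ v - fderiv ℝ ψ v (w - v) - 1 / 2 * A (w - v) (w - v) := by
        simp; ring
      rw [e] at this
      exact this.trans (le_of_eq (by ring))
    · have h1 := hgrad v hv y (hseg hy)
      rw [sub_right_comm] at h1
      refine h1.trans ?_
      have h2 := norm_sub_le_of_mem_segment hy
      gcongr

variable {v d : ℕ → V} {ν : ℕ → ℝ} {a : ℝ}

/-- Once `ν k ≤ 1`, the residual bound gives `‖B d‖ ≤ 2‖g‖`, and coercivity gives `a‖d‖ ≤ ‖B d‖`. -/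
lemma eventually_norm_newton_step_le (ha : 0 < a)
    (hcoer : ∀ᶠ k in atTop, ∀ u, a * ‖u‖ ^ 2 ≤ fderiv ℝ (fderiv ℝ ψ) (v k) u u)
    (hν : Tendsto ν atTop (𝓝 0))
    (hres : ∀ᶠ k in atTop, ‖fderiv ℝ (fderiv ℝ ψ) (v k) (d k) + fderiv ℝ ψ (v k)‖
      ≤ ν k * ‖fderiv ℝ ψ (v k)‖) :
    ∀ᶠ k in atTop, ‖d k‖ ≤ 2 / a * ‖fderiv ℝ ψ (v k)‖ := by
  filter_upwards [hcoer, hres, hν.eventually (gt_mem_nhds one_pos)] with k h1 h2 h3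
  have h4 := h1 (d k)
  have h5 : fderiv ℝ (fderiv ℝ ψ) (v k) (d k) (d k)
      ≤ ‖fderiv ℝ (fderiv ℝ ψ) (v k) (d k)‖ * ‖d k‖ :=
    (Real.le_norm_self _).trans (ContinuousLinearMap.le_opNorm _ _)
  have h6 : ‖fderiv ℝ (fderiv ℝ ψ) (v k) (d k)‖ ≤ 2 * ‖fderiv ℝ ψ (v k)‖ := by
    have := _root_.norm_sub_le (fderiv ℝ (fderiv ℝ ψ) (v k) (d k) + fderiv ℝ ψ (v k))
      (fderiv ℝ ψ (v k))
    rw [add_sub_cancel_right] at this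
    nlinarith [norm_nonneg (fderiv ℝ ψ (v k))]
  rw [div_mul_eq_mul_div, le_div_iff₀ ha]
  rcases (norm_nonneg (d k)).eq_or_lt with h0 | h0
  · rw [← h0]; simp
  · have : ‖d k‖ * a * ‖d k‖ ≤ 2 * ‖fderiv ℝ ψ (v k)‖ * ‖d k‖ := by nlinarith
    exact le_of_mul_le_mul_right this h0

lemma tendsto_fderiv_of_tendsto (hψ : ContDiffAt ℝ 2 ψ z) (hz : fderiv ℝ ψ z = 0)
    (hv : Tendsto v atTop (𝓝 z)) : Tendsto (fun k => ‖fderiv ℝ ψ (v k)‖) atTop (𝓝 0) := by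
  have h := ((hψ.fderiv_right (m := 1) (by norm_num)).continuousAt.tendsto.comp hv).norm
  rw [hz, norm_zero] at h
  exact h

lemma tendsto_newton_step (ha : 0 < a) (hψ : ContDiffAt ℝ 2 ψ z) (hz : fderiv ℝ ψ z = 0)
    (hv : Tendsto v atTop (𝓝 z))
    (hcoer : ∀ᶠ k in atTop, ∀ u, a * ‖u‖ ^ 2 ≤ fderiv ℝ (fderiv ℝ ψ) (v k) u u)
    (hν : Tendsto ν atTop (𝓝 0))
    (hres : ∀ᶠ k in atTop, ‖fderiv ℝ (fderiv ℝ ψ) (v k) (d k) + fderiv ℝ ψ (v k)‖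
      ≤ ν k * ‖fderiv ℝ ψ (v k)‖) : Tendsto d atTop (𝓝 0) := by
  have h := (tendsto_fderiv_of_tendsto hψ hz hv).const_mul (2 / a)
  rw [mul_zero] at h
  exact squeeze_zero_norm' (eventually_norm_newton_step_le ha hcoer hν hres) h

/-- Inexact Newton steps finally satisfy the Armijo condition with unit step size. -/
lemma eventually_newton_armijo (ha : 0 < a) (hψ : ContDiffAt ℝ 2 ψ z)
    (hLip : ∃ K : NNReal, ∃ U ∈ 𝓝 z, LipschitzOnWith K (fderiv ℝ (fderiv ℝ ψ)) U)
    (hz : fderiv ℝ ψ z = 0) (hv : Tendsto v atTop (𝓝 z))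
    (hcoer : ∀ᶠ k in atTop, ∀ u, a * ‖u‖ ^ 2 ≤ fderiv ℝ (fderiv ℝ ψ) (v k) u u)
    (hν : Tendsto ν atTop (𝓝 0))
    (hres : ∀ᶠ k in atTop, ‖fderiv ℝ (fderiv ℝ ψ) (v k) (d k) + fderiv ℝ ψ (v k)‖
      ≤ ν k * ‖fderiv ℝ ψ (v k)‖) {η : ℝ} (hη0 : 0 < η) (hη : η < 1 / 2) :
    ∀ᶠ k in atTop, ψ (v k + d k) ≤ ψ (v k) + η * fderiv ℝ ψ (v k) (d k) := by
  obtain ⟨K, M, δ, hK, hM, hδ, hT⟩ := exists_taylor_bounds hψ hLip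
  have hd := tendsto_newton_step ha hψ hz hv hcoer hν hres
  have hvd : Tendsto (fun k => v k + d k) atTop (𝓝 z) := by simpa using hv.add hd
  have hlim : Tendsto (fun k => 2 * M * |ν k| + K * ‖d k‖) atTop (𝓝 0) := by
    simpa using (hν.abs.const_mul (2 * M)).add (hd.norm.const_mul K)
  have hball := Metric.ball_mem_nhds z hδ
  filter_upwards [hv.eventually hball, hvd.eventually hball, hcoer, hres,
    -- `ν k < 1/2` yields `‖g‖ ≤ 2M‖d‖`; the last condition makes all errors, relative to `‖d‖²`,
    -- smaller than `(1/2 - η) a`.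
    hν.eventually (gt_mem_nhds (half_pos one_pos)),
    hlim.eventually (gt_mem_nhds (mul_pos (sub_pos.mpr hη) ha))] with k hv1 hv2 hc hr hν1 hl
  obtain ⟨hA, hw⟩ := hT _ hv1
  have h1 := le_of_abs_le (hw _ hv2).2.2
  rw [add_sub_cancel_left] at h1
  have hc' := hc (d k)
  set g := fderiv ℝ ψ (v k) with hg
  set B := fderiv ℝ (fderiv ℝ ψ) (v k) with hB
  have h2 : ‖g‖ ≤ 2 * M * ‖d k‖ := by
    have h3 := _root_.norm_sub_le (B (d k) + g) (B (d k))
    rw [add_sub_cancel_left] at h3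
    have h4 := (B.le_opNorm (d k)).trans (mul_le_mul_of_nonneg_right hA (norm_nonneg _))
    nlinarith [norm_nonneg g]
  have h5 : (B (d k) + g) (d k) ≤ 2 * M * |ν k| * ‖d k‖ ^ 2 := by
    have h6 := (Real.le_norm_self _).trans ((B (d k) + g).le_opNorm (d k))
    have h7 : ‖B (d k) + g‖ ≤ |ν k| * (2 * M * ‖d k‖) :=
      hr.trans (mul_le_mul (le_abs_self _) h2 (norm_nonneg _) (abs_nonneg _))
    have h8 := mul_le_mul_of_nonneg_right h7 (norm_nonneg (d k))
    linarith
  have h9 : (B (d k) + g) (d k) = B (d k) (d k) + g (d k) := rfl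
  rw [h9] at h5
  have h10 := mul_le_mul_of_nonneg_right hl.le (sq_nonneg ‖d k‖)
  have h11 := mul_le_mul_of_nonneg_left h5 (by linarith : 0 ≤ 1 - η)
  have h12 : (1 - η) * (2 * M * |ν k| * ‖d k‖ ^ 2) ≤ 2 * M * |ν k| * ‖d k‖ ^ 2 :=
    mul_le_of_le_one_left (by positivity) (by linarith)
  -- The identity behind this is `(1-η) g(d) + ½ B(d,d) = (1-η)(B d + g)(d) - (½-η) B(d,d)`.
  nlinarith

/-- The error after an inexact Newton step. -/
lemma eventually_newton_error (hψ : ContDiffAt ℝ 2 ψ z)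
    (hLip : ∃ K : NNReal, ∃ U ∈ 𝓝 z, LipschitzOnWith K (fderiv ℝ (fderiv ℝ ψ)) U)
    (hz : fderiv ℝ ψ z = 0) (hv : Tendsto v atTop (𝓝 z))
    (hcoer : ∀ᶠ k in atTop, ∀ u, a * ‖u‖ ^ 2 ≤ fderiv ℝ (fderiv ℝ ψ) (v k) u u) :
    ∃ K M : ℝ, 0 ≤ K ∧ 0 ≤ M ∧ ∀ᶠ k in atTop, ‖fderiv ℝ ψ (v k)‖ ≤ M * ‖v k - z‖ ∧
      a * ‖v k + d k - z‖ ≤ K * ‖v k - z‖ ^ 2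
        + ‖fderiv ℝ (fderiv ℝ ψ) (v k) (d k) + fderiv ℝ ψ (v k)‖ := by
  obtain ⟨K, M, δ, hK, hM, hδ, hT⟩ := exists_taylor_bounds hψ hLip
  refine ⟨K, M, hK, hM, ?_⟩
  filter_upwards [hv.eventually (Metric.ball_mem_nhds z hδ), hcoer] with k hv1 hc
  obtain ⟨h1, h2, -⟩ := (hT _ hv1).2 z (Metric.mem_ball_self hδ)
  rw [hz, zero_sub] at h1 h2
  rw [norm_neg, norm_sub_rev z] at h1
  rw [norm_sub_rev z] at h2
  refine ⟨h1, ?_⟩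
  set g := fderiv ℝ ψ (v k) with hg
  set B := fderiv ℝ (fderiv ℝ ψ) (v k) with hB
  -- Taylor remainder at `z`, where the gradient vanishes, plus the residual of the Newton equation.
  have e : B (v k + d k - z) = (-g - B (z - v k)) + (B (d k) + g) := by
    simp only [map_add, map_sub]; abel
  have h3 : ‖B (v k + d k - z)‖ ≤ K * ‖v k - z‖ ^ 2 + ‖B (d k) + g‖ := by
    rw [e]
    exact (norm_add_le _ _).trans (by linarith)
  have h4 := hc (v k + d k - z)
  have h5 := (Real.le_norm_self _).trans ((B (v k + d k - z)).le_opNorm (v k + d k - z))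
  refine le_trans ?_ h3
  rcases (norm_nonneg (v k + d k - z)).eq_or_lt with h0 | h0
  · rw [← h0, mul_zero]; exact norm_nonneg _
  · refine le_of_mul_le_mul_right ?_ h0
    linarith

end Newton

/-! ### The objective on a coordinate subspace -/

/-- The objective as a function of the variables in `S`, the other variables being zero. -/
noncomputable def Problem.reduced (P : Problem n m) (S : Finset (Fin n))
    (v : EuclideanSpace ℝ S) : ℝ := P.F (pad S v)

/-- The Lipschitz property of second derivatives is inherited by restrictions to subspaces. -/
lemma lipschitz_fderiv_fderiv_comp {V W : Type*} [NormedAddCommGroup V] [NormedSpace ℝ V]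
    [NormedAddCommGroup W] [NormedSpace ℝ W] {f : W → ℝ} (hf : ContDiff ℝ 2 f) (L : V →ₗᵢ[ℝ] W)
    {K : NNReal} {U : Set W} (hU : LipschitzOnWith K (fderiv ℝ (fderiv ℝ f)) U) :
    ∃ K' : NNReal, LipschitzOnWith K' (fderiv ℝ (fderiv ℝ (f ∘ L))) (L ⁻¹' U) := by
  let L' : V →L[ℝ] W := L.toContinuousLinearMap
  let C : (W →L[ℝ] ℝ) →L[ℝ] (V →L[ℝ] ℝ) := (ContinuousLinearMap.compL ℝ V W ℝ).flip L'
  have h1 : fderiv ℝ (f ∘ L) = fun v => C (fderiv ℝ f (L' v)) := by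
    funext v
    exact (((hf.differentiable (by norm_num)) (L' v)).hasFDerivAt.comp v L'.hasFDerivAt).fderiv
  have h2 : ∀ v, fderiv ℝ (fderiv ℝ (f ∘ L)) v
      = C.comp ((fderiv ℝ (fderiv ℝ f) (L' v)).comp L') := by
    intro v
    rw [h1]
    have h3 : DifferentiableAt ℝ (fderiv ℝ f) (L' v) :=
      (hf.fderiv_right (m := 1) (by norm_num)).differentiable (by norm_num) _
    exact (C.hasFDerivAt.comp v (h3.hasFDerivAt.comp v L'.hasFDerivAt)).fderiv
  refine ⟨‖C‖₊ * (K * ‖L'‖₊), LipschitzOnWith.of_dist_le_mul fun v hv w hw => ?_⟩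
  have h4 := hU.dist_le_mul (L v) hv (L w) hw
  rw [L.isometry.dist_eq, dist_eq_norm] at h4
  rw [dist_eq_norm, h2, h2, ← ContinuousLinearMap.comp_sub, ← ContinuousLinearMap.sub_comp]
  refine (ContinuousLinearMap.opNorm_comp_le _ _).trans ?_
  push_cast
  rw [mul_assoc]
  refine mul_le_mul_of_nonneg_left ?_ (norm_nonneg _)
  refine (ContinuousLinearMap.opNorm_comp_le _ _).trans ?_
  calc _ ≤ (K * dist v w) * ‖L'‖ := mul_le_mul_of_nonneg_right h4 (norm_nonneg _)
    _ = _ := by ring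

namespace Problem

variable {P : Problem n m} {xstar : E n}

lemma pad_sub_support (x : E n) : pad (P.support x) (sub (P.support x) x) = x :=
  pad_sub_of_forall_eq_zero fun _ hj => apply_eq_zero_of_notMem_support hj

/-- On the subspace, groups off the support vanish identically and the others stay away from zero
near `xstar`. -/
lemma contDiffAt_r_pad (k : WithTop ℕ∞) :
    ContDiffAt ℝ k (fun v => P.r (pad (P.support xstar) v)) (sub (P.support xstar) xstar) := by
  unfold r
  refine ContDiffAt.sum fun i _ => contDiffAt_const.mul ?_
  by_cases hi : sub (P.G i) xstar = 0
  · have h0 : ∀ v, ‖sub (P.G i) (pad (P.support xstar) v)‖ = 0 := by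
      intro v
      rw [norm_eq_zero, sub_eq_zero_iff]
      exact fun j hj => pad_apply_of_notMem v fun hjs => (mem_support hj xstar).mp hjs hi
    simp only [h0]
    exact contDiffAt_const
  · have h1 : ContDiffAt ℝ k (fun v => sub (P.G i) (pad (P.support xstar) v))
        (sub (P.support xstar) xstar) :=
      ((subL (P.G i)).comp (padL (P.support xstar)).toContinuousLinearMap).contDiff.contDiffAt
    refine h1.norm ℝ ?_
    rwa [pad_sub_support]

lemma contDiffAt_reduced (hf : ContDiff ℝ 2 P.f) :
    ContDiffAt ℝ 2 (P.reduced (P.support xstar)) (sub (P.support xstar) xstar) :=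
  (hf.comp (padL (P.support xstar)).contDiff).contDiffAt.add (contDiffAt_r_pad 2)

lemma lipschitz_hessian_reduced (hf : ContDiff ℝ 2 P.f)
    (hlip : ∃ U ∈ 𝓝 xstar, ∃ K : NNReal, LipschitzOnWith K (fderiv ℝ (fderiv ℝ P.f)) U) :
    ∃ K : NNReal, ∃ U ∈ 𝓝 (sub (P.support xstar) xstar),
      LipschitzOnWith K (fderiv ℝ (fderiv ℝ (P.reduced (P.support xstar)))) U := by
  set S := P.support xstar with hS
  set z := sub S xstar with hz
  obtain ⟨U, hU, K, hK⟩ := hlip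
  obtain ⟨K₁, hK₁⟩ := lipschitz_fderiv_fderiv_comp hf (padL S) hK
  have hU₁ : padL S ⁻¹' U ∈ 𝓝 z := by
    refine (padL S).continuous.continuousAt.preimage_mem_nhds ?_
    rwa [padL_apply, hz, hS, pad_sub_support]
  -- One order more than needed for the Hessian, so that the Hessian of this part is C¹ and hence
  -- Lipschitz near `z`.
  have hr3 : ContDiffAt ℝ 3 (fun v => P.r (pad S v)) z := contDiffAt_r_pad 3
  obtain ⟨K₂, U₂, hU₂, hK₂⟩ := ((hr3.fderiv_right (m := 2) (by norm_num)).fderiv_right (m := 1)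
    (by norm_num)).exists_lipschitzOnWith
  have hfL : ContDiff ℝ 2 (P.f ∘ padL S) := hf.comp (padL S).contDiff
  have hev3 : ∀ᶠ v in 𝓝 z, ContDiffAt ℝ 3 (fun v => P.r (pad S v)) v := hr3.eventually (by simp)
  have he1 : ∀ᶠ v in 𝓝 z, fderiv ℝ (P.reduced S) v
      = fderiv ℝ (P.f ∘ padL S) v + fderiv ℝ (fun v => P.r (pad S v)) v := by
    filter_upwards [hev3] with v hv
    exact fderiv_add ((hfL.differentiable (by norm_num)) v) (hv.differentiableAt (by norm_num))
  have he2 : ∀ᶠ v in 𝓝 z, fderiv ℝ (fderiv ℝ (P.reduced S)) v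
      = fderiv ℝ (fderiv ℝ (P.f ∘ padL S)) v
        + fderiv ℝ (fderiv ℝ (fun v => P.r (pad S v))) v := by
    filter_upwards [hev3, he1.eventually_nhds] with v hv hev
    rw [EventuallyEq.fderiv_eq hev]
    exact fderiv_add
      ((hfL.fderiv_right (m := 1) (by norm_num)).differentiable (by norm_num) v)
      ((hv.fderiv_right (m := 2) (by norm_num)).differentiableAt (by norm_num))
  refine ⟨K₁ + K₂, _, inter_mem (inter_mem hU₁ hU₂) he2, ?_⟩
  intro v hv w hw
  have h1 := (hK₁.mono Set.inter_subset_left).add (hK₂.mono Set.inter_subset_right) hv.1 hw.1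
  rw [(hv.2 : _ = _), (hw.2 : _ = _)]
  exact h1

lemma fderiv_reduced_eq_zero (hstar : IsMinOn P.F Set.univ xstar) :
    fderiv ℝ (P.reduced (P.support xstar)) (sub (P.support xstar) xstar) = 0 := by
  refine IsLocalMin.fderiv_eq_zero (Eventually.of_forall fun v => ?_)
  rw [reduced, reduced, pad_sub_support]
  exact hstar (Set.mem_univ _)

section Translation

variable {S : Finset (Fin n)} {v : EuclideanSpace ℝ S}

lemma partialD_F_pad (w : EuclideanSpace ℝ S) (j : S) :
    partialD P.F j (pad S w) = lineDeriv ℝ (P.reduced S) w (EuclideanSpace.single j 1) := by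
  simp only [partialD, lineDeriv, reduced, pad_add, pad_smul, pad_single]

lemma inner_eq_fderiv_of_coord {L : EuclideanSpace ℝ S →L[ℝ] ℝ} {g : EuclideanSpace ℝ S}
    (h : ∀ j, g j = L (EuclideanSpace.single j 1)) (u : EuclideanSpace ℝ S) :
    inner ℝ g u = L u := by
  have hu : u = ∑ j, u j • EuclideanSpace.single j (1 : ℝ) := by
    ext i
    simp [Pi.single_apply]
  conv_rhs => rw [hu]
  rw [PiLp.inner_apply, map_sum]
  simp [h]

lemma inner_gradSub_pad (hv : DifferentiableAt ℝ (P.reduced S) v) (u : EuclideanSpace ℝ S) :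
    inner ℝ (gradSub S P.F (pad S v)) u = fderiv ℝ (P.reduced S) v u := by
  refine inner_eq_fderiv_of_coord (fun j => ?_) u
  rw [← hv.lineDeriv_eq_fderiv, ← partialD_F_pad]
  rfl

lemma hessSub_pad (hv : ContDiffAt ℝ 2 (P.reduced S) v) (i j : S) :
    hessSub S P.F (pad S v) i j = fderiv ℝ (fderiv ℝ (P.reduced S)) v
      (EuclideanSpace.single i 1) (EuclideanSpace.single j 1) := by
  have h1 : hessSub S P.F (pad S v) i j
      = lineDeriv ℝ (fun w => partialD P.F j (pad S w)) v (EuclideanSpace.single i 1) := by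
    simp only [hessSub, Matrix.of_apply, lineDeriv, pad_add, pad_smul, pad_single]
    rfl
  have h2 : (fun w => partialD P.F j (pad S w))
      =ᶠ[𝓝 v] fun w => fderiv ℝ (P.reduced S) w (EuclideanSpace.single j 1) := by
    filter_upwards [hv.eventually (by simp)] with w hw
    rw [partialD_F_pad, (hw.differentiableAt (by norm_num)).lineDeriv_eq_fderiv]
  have h3 : HasFDerivAt (fderiv ℝ (P.reduced S)) (fderiv ℝ (fderiv ℝ (P.reduced S)) v) v :=
    ((hv.fderiv_right (m := 1) (by norm_num)).differentiableAt (by norm_num)).hasFDerivAt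
  have h4 := (h3.clm_apply (hasFDerivAt_const (EuclideanSpace.single j (1 : ℝ)) v)).hasLineDerivAt
    (EuclideanSpace.single i (1 : ℝ))
  rw [h1, h2.lineDeriv_eq, h4.lineDeriv]
  simp

lemma inner_mulV_hessSub_pad (hv : ContDiffAt ℝ 2 (P.reduced S) v) (d u : EuclideanSpace ℝ S) :
    inner ℝ (mulV (hessSub S P.F (pad S v)) d) u = fderiv ℝ (fderiv ℝ (P.reduced S)) v d u := by
  refine inner_eq_fderiv_of_coord (fun i => ?_) u
  have h1 : mulV (hessSub S P.F (pad S v)) d i = ∑ j, hessSub S P.F (pad S v) i j * d j := rfl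
  -- Symmetry moves `d` to the second slot, where row `i` of the Hessian acts.
  rw [h1, (hv.isSymmSndFDerivAt (by simp)).eq d, ← inner_eq_fderiv_of_coord
    (g := WithLp.toLp 2 fun j => hessSub S P.F (pad S v) i j) (fun j => hessSub_pad hv i j),
    PiLp.inner_apply]
  simp [mul_comm]

lemma norm_eq_of_inner_eq {g : EuclideanSpace ℝ S} {L : EuclideanSpace ℝ S →L[ℝ] ℝ}
    (h : ∀ u, inner ℝ g u = L u) : ‖g‖ = ‖L‖ := by
  have : InnerProductSpace.toDual ℝ (EuclideanSpace ℝ S) g = L := by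
    ext u
    simpa using h u
  rw [← this, LinearIsometryEquiv.norm_map]

/-- The conditions on the direction, in terms of the derivatives of the reduced objective. -/
lemma direction_reduced {I : Finset (Fin n)} (hI : I = S) (hv : ContDiffAt ℝ 2 (P.reduced S) v)
    {H : Matrix I I ℝ} {μ q a : ℝ} {d : EuclideanSpace ℝ I}
    (hd : IsCGDirection (gradSub I P.F (pad S v)) H μ q d) (hH : H = hessSub I P.F (pad S v))
    (hlow : ∀ u : EuclideanSpace ℝ I, a * ‖u‖ ^ 2 ≤ inner ℝ u (mulV H u)) :
    pad S (sub S (pad I d)) = pad I d ∧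
      (∀ u, a * ‖u‖ ^ 2 ≤ fderiv ℝ (fderiv ℝ (P.reduced S)) v u u) ∧
      ‖fderiv ℝ (fderiv ℝ (P.reduced S)) v (sub S (pad I d)) + fderiv ℝ (P.reduced S) v‖
        ≤ μ * ‖fderiv ℝ (P.reduced S) v‖ ^ q ∧
      inner ℝ (gradSub I P.F (pad S v)) d = fderiv ℝ (P.reduced S) v (sub S (pad I d)) := by
  subst hI hH
  have hg := inner_gradSub_pad (P := P) (hv.differentiableAt (by norm_num))
  have hH := inner_mulV_hessSub_pad (P := P) hv
  rw [sub_pad]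
  refine ⟨rfl, fun u => ?_, ?_, hg d⟩
  · rw [← hH, real_inner_comm]
    exact hlow u
  · rw [← norm_eq_of_inner_eq hg, ← norm_eq_of_inner_eq
      (g := mulV (hessSub I P.F (pad I v)) d + gradSub I P.F (pad I v)) fun u => by
        rw [inner_add_left, hg, hH]; rfl]
    exact hd.2.2

end Translation

end Problem

/-! ### From the identified subspace to the error recursion -/

namespace Trace.IsRegularRun

variable {t : Trace n} {P : Problem n m} {c : Constants} {xstar : E n} {σ a b : ℝ}

/-- A subspace step with an acceptable unit step that stays away from the kinks of the
regularizer. -/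
lemma x_next_eq (h : t.IsRegularRun P c xstar σ a b) {k : ℕ} (hk : k ∈ t.Kcg P c)
    (hnorm : ∀ i, P.G i ⊆ t.I k → 2 * ‖pad (t.I k) (t.dbar k)‖
      < (1 - Real.sin c.θ) * ‖sub (P.G i) (t.x k)‖)
    (hF : P.F (t.x k + pad (t.I k) (t.dbar k)) ≤ P.F (t.x k)
      + c.η * inner ℝ (gradSub (t.I k) P.F (t.x k)) (t.dbar k)) :
    t.x (k + 1) = t.x k + pad (t.I k) (t.dbar k) := by
  obtain ⟨j, hj, hx⟩ := (h.run.cg k hk).x_next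
  have hτ : ¬ P.τmin c (t.x k) (t.s k) (pad (t.I k) (t.dbar k)) (t.I k)
      ≤ ((c.ξ ^ 0 : ℝ) : EReal) := by
    rw [not_le, pow_zero]
    -- The factor 2 in `hnorm` gives `2 ≤ τ`, so that `ξ^0 = 1` is strictly below `τ`.
    exact lt_of_lt_of_le (EReal.coe_lt_coe_iff.mpr one_lt_two)
      (Problem.le_τmin_of_norm_le two_pos hnorm)
  have hacc : P.cgAccept c (t.x k) (t.s k) (pad (t.I k) (t.dbar k)) (t.I k) 0 := by
    rw [Problem.cgAccept, if_neg hτ, Problem.cgTrial_of_not_τmin_le hτ, pow_zero, one_smul,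
      mul_one, sub_pad]
    exact hF
  have hj0 : j = 0 := Nat.le_zero.mp (hj.2 hacc)
  rw [hx, hj0, Problem.cgTrial_of_not_τmin_le hτ, pow_zero, one_smul]

/-- Finally the iterates satisfy the error recursion of an inexact Newton method. -/
lemma exists_error_recursion (h : t.IsRegularRun P c xstar σ a b)
    (hlip : ∃ U ∈ 𝓝 xstar, ∃ K : NNReal, LipschitzOnWith K (fderiv ℝ (fderiv ℝ P.f)) U)
    (hnondeg : ∀ i, sub (P.G i) xstar = 0 → ‖sub (P.G i) (gradient P.f xstar)‖ < P.weight i)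
    (hη : c.η < 1 / 2)
    (hI : ∀ᶠ k in atTop, (k ∈ t.Kcg P c → t.I k = P.Icg c (t.x k) (t.s k)) ∧
      (k ∉ t.Kcg P c → t.I k = P.Ipg c (t.x k) (t.s k)))
    (hHess : ∀ᶠ k in atTop, k ∈ t.Kcg P c → t.H k = hessSub (t.I k) P.F (t.x k))
    (hq : 1 < c.q ∨ (c.q = 1 ∧ Tendsto t.μ (atTop ⊓ 𝓟 (t.Kcg P c)) (𝓝 0))) :
    Tendsto t.x atTop (𝓝 xstar) ∧
    ∃ (K M : ℝ) (ν : ℕ → ℝ), 0 ≤ K ∧ 0 ≤ M ∧ Tendsto ν atTop (𝓝 0) ∧ ∀ᶠ k in atTop,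
      a * ‖t.x (k + 1) - xstar‖ ≤ K * ‖t.x k - xstar‖ ^ 2 + ν k * (M * ‖t.x k - xstar‖) ∧
      (c.q = 2 → ν k ≤ M * ‖t.x k - xstar‖) := by
  have hx := h.tendsto_x (hI.mono fun k hk => hk.1)
  refine ⟨hx, ?_⟩
  have hmem := h.eventually_mem_Kcg hx hnondeg hI
  set S := P.support xstar with hS
  set ψ := P.reduced S with hψdef
  set z := sub S xstar with hz
  have hpadz : pad S z = xstar := Problem.pad_sub_support xstar
  let v : ℕ → EuclideanSpace ℝ S := fun k => sub S (t.x k)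
  -- The type of `dbar k` depends on `I k`, which equals `S` only finally; this moves all directions
  -- to one space.
  let d : ℕ → EuclideanSpace ℝ S := fun k => sub S (pad (t.I k) (t.dbar k))
  have hv : Tendsto v atTop (𝓝 z) := ((continuous_sub S).tendsto xstar).comp hx
  have hψ : ContDiffAt ℝ 2 ψ z := Problem.contDiffAt_reduced h.contDiff
  have hLip := Problem.lipschitz_hessian_reduced h.contDiff hlip
  have hgz : fderiv ℝ ψ z = 0 := Problem.fderiv_reduced_eq_zero h.isMin
  have hdata : ∀ᶠ k in atTop, k ∈ t.Kcg P c ∧ t.I k = S ∧ pad S (v k) = t.x k ∧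
      pad S (d k) = pad (t.I k) (t.dbar k) ∧
      (∀ u, a * ‖u‖ ^ 2 ≤ fderiv ℝ (fderiv ℝ ψ) (v k) u u) ∧
      ‖fderiv ℝ (fderiv ℝ ψ) (v k) (d k) + fderiv ℝ ψ (v k)‖
        ≤ t.μ k * ‖fderiv ℝ ψ (v k)‖ ^ c.q ∧
      inner ℝ (gradSub (t.I k) P.F (t.x k)) (t.dbar k) = fderiv ℝ ψ (v k) (d k) := by
    filter_upwards [hmem, hHess, hv.eventually (hψ.eventually (by simp))] with k ⟨hk, hIk, h0⟩ hHk hψk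
    have hpad : pad S (v k) = t.x k := pad_sub_of_forall_eq_zero h0
    have hd := (h.run.cg k hk).direction
    have hH := hHk hk
    rw [← hpad] at hd hH
    -- Coercivity of the reduced Hessian is inherited from the lower bound on `H k`.
    obtain ⟨h1, h2, h3, h4⟩ :=
      Problem.direction_reduced hIk hψk hd hH fun u => (h.H_bound k hk u).1
    rw [hpad] at h4
    exact ⟨hk, hIk, hpad, h1, h2, h3, h4⟩
  have hg := tendsto_fderiv_of_tendsto hψ hgz hv
  have hcg : ∀ᶠ k in atTop, k ∈ t.Kcg P c := hdata.mono fun k hk => hk.1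
  have hq1 : 0 ≤ c.q - 1 := sub_nonneg.mpr c.q_mem.1
  -- The relative residual, from `‖g‖^q = ‖g‖^(q-1) ‖g‖`. It vanishes through the power if `q > 1`,
  -- and through `μ` if `q = 1`.
  let ν : ℕ → ℝ := fun k => t.μ k * ‖fderiv ℝ ψ (v k)‖ ^ (c.q - 1)
  have hμ : ∀ᶠ k in atTop, 0 ≤ t.μ k ∧ t.μ k ≤ 1 := hcg.mono fun k hk =>
    ⟨(h.run.cg k hk).μ_mem.1.le, (h.run.cg k hk).μ_mem.2⟩
  have hν : Tendsto ν atTop (𝓝 0) := by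
    rcases hq with hq | ⟨hq, hμ0⟩
    · have h1 : Tendsto (fun k => ‖fderiv ℝ ψ (v k)‖ ^ (c.q - 1)) atTop (𝓝 0) := by
        have := hg.rpow_const (p := c.q - 1) (Or.inr hq1)
        rwa [Real.zero_rpow (sub_pos.mpr hq).ne'] at this
      refine squeeze_zero_norm' ?_ h1
      filter_upwards [hμ] with k hk
      have h2 : 0 ≤ ‖fderiv ℝ ψ (v k)‖ ^ (c.q - 1) := Real.rpow_nonneg (norm_nonneg _) _
      rw [Real.norm_of_nonneg (mul_nonneg hk.1 h2)]
      exact mul_le_of_le_one_left h2 hk.2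
    · have h1 : atTop ⊓ 𝓟 (t.Kcg P c) = atTop := inf_eq_left.mpr (le_principal_iff.mpr hcg)
      rw [h1] at hμ0
      simpa [ν, hq] using hμ0
  have hres : ∀ᶠ k in atTop, ‖fderiv ℝ (fderiv ℝ ψ) (v k) (d k) + fderiv ℝ ψ (v k)‖
      ≤ ν k * ‖fderiv ℝ ψ (v k)‖ := by
    filter_upwards [hdata] with k hk
    refine hk.2.2.2.2.2.1.trans (le_of_eq ?_)
    have : ‖fderiv ℝ ψ (v k)‖ ^ c.q = ‖fderiv ℝ ψ (v k)‖ ^ (c.q - 1) * ‖fderiv ℝ ψ (v k)‖ := by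
      have hq0 : c.q - 1 + 1 ≠ 0 := by linarith
      rw [← Real.rpow_add_one' (norm_nonneg _) hq0, sub_add_cancel]
    rw [this]
    ring
  have hcoer : ∀ᶠ k in atTop, ∀ u, a * ‖u‖ ^ 2 ≤ fderiv ℝ (fderiv ℝ ψ) (v k) u u :=
    hdata.mono fun k hk => hk.2.2.2.2.1
  have hd0 := tendsto_newton_step h.a_pos hψ hgz hv hcoer hν hres
  have harm := eventually_newton_armijo h.a_pos hψ hLip hgz hv hcoer hν hres c.η_mem.1 hη
  obtain ⟨K, M, hK, hM, herr⟩ := eventually_newton_error (d := d) hψ hLip hgz hv hcoer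
  have hfar : ∀ᶠ k in atTop, ∀ i, P.G i ⊆ S →
      2 * ‖d k‖ < (1 - Real.sin c.θ) * ‖sub (P.G i) (t.x k)‖ := by
    rw [eventually_all]
    intro i
    by_cases hi : P.G i ⊆ S
    swap
    · exact Eventually.of_forall fun k h0 => absurd h0 hi
    obtain ⟨j, hj⟩ := P.group_nonempty i
    have hne : sub (P.G i) xstar ≠ 0 := (Problem.mem_support hj xstar).mp (hi hj)
    have h1 : Tendsto (fun k => (1 - Real.sin c.θ) * ‖sub (P.G i) (t.x k)‖) atTop
        (𝓝 ((1 - Real.sin c.θ) * ‖sub (P.G i) xstar‖)) :=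
      (((continuous_sub (P.G i)).tendsto xstar).comp hx).norm.const_mul _
    have h2 : Tendsto (fun k => 2 * ‖d k‖) atTop (𝓝 0) := by simpa using hd0.norm.const_mul 2
    have h3 : 0 < (1 - Real.sin c.θ) * ‖sub (P.G i) xstar‖ :=
      mul_pos (sub_pos.mpr (Problem.sin_θ_mem c).2) (norm_pos_iff.mpr hne)
    exact (h2.eventually_lt h1 h3).mono fun k hk _ => hk
  refine ⟨K, M, ν, hK, hM, hν, ?_⟩
  filter_upwards [hdata, hres, harm, herr, hfar, hμ] with k
    ⟨hk, hIk, hpv, hpd, _, _, hin⟩ hr ha ⟨he1, he2⟩ hf hμk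
  have hnext : t.x (k + 1) = pad S (v k + d k) := by
    rw [pad_add, hpv, hpd]
    refine h.x_next_eq hk (fun i hi => ?_) ?_
    · rw [← hpd, norm_pad]
      exact hf i (hIk ▸ hi)
    · rw [hin, ← hpd]
      simpa only [hψdef, Problem.reduced, pad_add, hpv] using ha
  have hn1 : ‖t.x (k + 1) - xstar‖ = ‖v k + d k - z‖ := by
    rw [hnext, ← hpadz, ← padL_apply, ← padL_apply, ← map_sub, LinearIsometry.norm_map]
  have hn2 : ‖t.x k - xstar‖ = ‖v k - z‖ := by
    rw [← hpv, ← hpadz, ← padL_apply, ← padL_apply, ← map_sub, LinearIsometry.norm_map]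
  rw [hn1, hn2]
  have hν0 : 0 ≤ ν k := mul_nonneg hμk.1 (Real.rpow_nonneg (norm_nonneg _) _)
  refine ⟨he2.trans ?_, fun hq2 => ?_⟩
  · have := hr.trans (mul_le_mul_of_nonneg_left he1 hν0)
    linarith
  · have : ν k = t.μ k * ‖fderiv ℝ ψ (v k)‖ := by
      simp only [ν, hq2]
      norm_num
    rw [this]
    exact (mul_le_of_le_one_left (norm_nonneg _) hμk.2).trans he1

end Trace.IsRegularRun

end FaRSA

/-! ### Convergence rates -/

theorem mainTheorem4 {n m : ℕ} (P : FaRSA.Problem n m) (c : FaRSA.Constants)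
    (t : FaRSA.Trace n) (xstar : FaRSA.E n)
    -- `f` is twice continuously differentiable and strongly convex; `xstar` solves the problem
    (hf : ContDiff ℝ 2 P.f)
    (hconv : ∃ σ : ℝ, 0 < σ ∧ StrongConvexOn Set.univ σ P.f)
    (hstar : IsMinOn P.F Set.univ xstar)
    -- the Hessian of `f` is Lipschitz near `xstar`, and `f + r` is nondegenerate at `xstar`
    (hlip : ∃ U ∈ 𝓝 xstar, ∃ K : NNReal, LipschitzOnWith K (fderiv ℝ (fderiv ℝ P.f)) U)
    (hnondeg : ∀ i, FaRSA.sub (P.G i) xstar = 0 →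
      ‖FaRSA.sub (P.G i) (gradient P.f xstar)‖ < P.weight i)
    -- the sequences are generated by the algorithm, which never meets an exact solution
    (hrun : t.IsRun P c)
    (hne : ∀ k, 0 < max (P.χcg c (t.x k) (t.s k)) (P.χpg c (t.x k) (t.s k)))
    -- the matrices `H k` are bounded and uniformly positive definite
    (hH : ∃ μmin μmax : ℝ, 0 < μmin ∧ μmin ≤ μmax ∧ ∀ k ∈ t.Kcg P c,
      ∀ v : EuclideanSpace ℝ (t.I k),
        μmin * ‖v‖ ^ 2 ≤ inner ℝ v (FaRSA.mulV (t.H k) v) ∧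
          inner ℝ v (FaRSA.mulV (t.H k) v) ≤ μmax * ‖v‖ ^ 2)
    -- algorithmic choices for the local analysis
    (hη : c.η < 1 / 2)
    (hI : ∀ᶠ k in atTop,
      (k ∈ t.Kcg P c → t.I k = P.Icg c (t.x k) (t.s k)) ∧
        (k ∉ t.Kcg P c → t.I k = P.Ipg c (t.x k) (t.s k)))
    (hHess : ∀ᶠ k in atTop, k ∈ t.Kcg P c → t.H k = FaRSA.hessSub (t.I k) P.F (t.x k))
    (hq : 1 < c.q ∨ (c.q = 1 ∧ Tendsto t.μ (atTop ⊓ 𝓟 (t.Kcg P c)) (𝓝 0))) :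
    FaRSA.ConvergesSuperlinearly t.x xstar ∧
      (c.q = 2 → FaRSA.ConvergesQuadratically t.x xstar) := by
  obtain ⟨σ, hσ, hconv⟩ := hconv
  obtain ⟨a, b, ha, hab, hbound⟩ := hH
  have h : t.IsRegularRun P c xstar σ a b := ⟨hf, hσ, hconv, hstar, hrun, ha, hab, hbound⟩
  obtain ⟨hx, K, M, ν, hK, hM, hν, hrec⟩ :=
    h.exists_error_recursion hlip hnondeg hη hI hHess hq
  have he : Tendsto (fun k => ‖t.x k - xstar‖) atTop (𝓝 0) :=
    tendsto_iff_norm_sub_tendsto_zero.mp hx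
  refine ⟨⟨hx, ?_⟩, fun hq2 => ⟨hx, ?_⟩⟩
  -- The recursion divided by `a ‖x k - xstar‖`: the contraction factor tends to zero.
  · have hlim : Tendsto (fun k => a⁻¹ * (K * ‖t.x k - xstar‖ + ν k * M)) atTop (𝓝 0) := by
      simpa using ((he.const_mul K).add (hν.mul_const M)).const_mul a⁻¹
    refine isLittleO_iff.mpr fun ε hε => ?_
    filter_upwards [hrec, hlim.eventually (gt_mem_nhds hε)] with k hk hk2
    rw [norm_norm, norm_norm]
    rw [inv_mul_lt_iff₀ ha] at hk2
    have h1 := mul_le_mul_of_nonneg_right hk2.le (norm_nonneg (t.x k - xstar))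
    refine le_of_mul_le_mul_left ?_ ha
    nlinarith [hk.1]
  -- Inserting `ν k ≤ M ‖x k - xstar‖` makes both terms of the recursion quadratic.
  · refine IsBigO.of_bound (a⁻¹ * (K + M * M)) ?_
    filter_upwards [hrec] with k hk
    rw [norm_norm, norm_pow, norm_norm, mul_assoc, ← div_eq_inv_mul, le_div_iff₀ ha]
    have h1 := mul_le_mul_of_nonneg_right (hk.2 hq2) (mul_nonneg hM (norm_nonneg (t.x k - xstar)))
    nlinarith [hk.1]
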